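/- **Setting.** Let $d\ge 0$, $K\ge 2$, $\mathcal W=[0,1]^d$. Let $\nu$ be a probability law on $\mathcal W$ (contexts) and $Q$ a Markov kernel from $[K]\times\mathcal W$ to $\{0,1\}$ (rewards). A *policy* is a map $g:[K]\times\mathcal W\to\mathbb R_+$ with $\sum_a g(a,w)=1$ for all $w$; $g_{\mathrm{ref}}\equiv 1/K$. A contextual bandit process with designs $g_1,g_2,\dots$ is a sequence $O_t=(W_t,A_t,Y_t)$, $t\ge1$, with $F_t=\sigma(O_1,\dots,O_t)$, such that each $g_t$ is an $F_{t-1}$-measurable random policy, $W_t\sim\nu$ is independent of $F_{t-1}$, $P[A_t=a\mid F_{t-1},W_t]=g_t(a,W_t)$, and $P[Y_t=y\mid F_{t-1},W_t,A_t]=Q(\{y\}\mid A_t,W_t)$. Let $\mathcal F_0$ be a class of measurable functions $\mathcal W\to\mathbb R$, and let $(\phi,\mathcal F)$ be either (direct) $\phi(x)=x$ and $\mathcal F=\{(a,w)\mapsto f_a(w): f_1,\dots,f_K\in\mathcal F_0,\ (f_a(w))_a \text{ in the probability simplex for all } w\}$, or (hinge) $\phi(x)=\max(0,1+x)$ and $\mathcal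 F=\{(a,w)\mapsto f_a(w): f_1,\dots,f_K\in\mathcal F_0,\ \sum_a f_a(w)=0\text{ for all } w\}$. Put $R^\phi(f)=E[\phi(f(A,W))(1-Y)]$ where $W\sim\nu$, $A\mid W\sim\mathrm{Unif}([K])$, $Y\mid A,W\sim Q$. Suppose that $f^*_{\mathcal F}\in\arg\min_{f\in\mathcal F}R^\phi(f)$ exists and that $\sup_{f_1,f_2\in\mathcal F}\sup_{a,w}|\phi(f_1(a,w))-\phi(f_2(a,w))|\le B$ for some $B>0$. The empirical $\phi$-risk minimizer at time $t$ is any $$\widehat f_t\in\arg\min_{f\in\mathcal F}\frac1t\sum_{\tau=1}^t\frac{g_{\mathrm{ref}}(A_\tau,W_\tau)}{g_\tau(A_\tau,W_\tau)}\,\phi(f(A_\tau,W_\tau))(1-Y_\tau).$$ Let $N_{[\,]}(\epsilon,\mathcal F,L_2(P))$ be the least number of brackets $[l,u]$ ($l,u$ measurable, $\|u-l\|_{L_2}\le\epsilon$) that cover $\mathcal F$, where $L_2(P)$ refers to the law $\mathrm{Unif}([K])\otimes\nu$ of $(A,W)$. **Statement.** Suppose that $\log(1+N_{[\,]}(\epsilon,\mathcal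 F,L_2(P)))=O(\epsilon^{-p})$ as $\epsilon\to0^+$ for some $p\in(0,1)$. Then $$R^\phi(\widehat f_t)-R^\phi(f^*_{\mathcal F})=O_P\Big((\delta t)^{-(\frac12\wedge\frac1p)}\Big)$$ in the following sense, uniform in $t$, $\delta$ and the designs. For every $\eta>0$ there is $M<\infty$, which does not depend on the process, the designs, $\delta$ or $t$, such that: 1. for every contextual bandit process with context law $\nu$ and reward kernel $Q$, every $t\ge1$ and every $\delta>0$ with $\min_{\tau\le t}\min_{a\in[K]}g_\tau(a,W_\tau)\ge\delta$ almost surely, $$P\Big[\,\big|R^\phi(\widehat f_t)-R^\phi(f^*_{\mathcal F})\big|>M(\delta t)^{-(\frac12\wedge\frac1p)}\Big]\le\eta;$$ 2. the same bound holds for every run of the $\varepsilon$-greedy algorithm with exploration rates $\delta_1,\delta_2,\dots\in[0,1]$, every $t\ge1$ and every $\delta>0$ with $\delta\le\delta_\tau$ for all $\tau\le t$. In this algorithm $\widehat\pi_0=g_{\mathrm{ref}}$, the design is $g_t=\delta_t g_{\mathrm{ref}}+(1-\delta_t)\widehat\pi_{t-1}$, $\widehat f_t$ is the empirical $\phi$-risk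 minimizer, and $\widehat\pi_t$ is $\widehat f_t$ itself (direct) or the policy that plays a maximizer of $a\mapsto\widehat f_t(a,w)$, ties being broken in any way (hinge). If $\widehat f_t$ is not measurable, $P$ of the event is its outer probability. -/

import Mathlib

open MeasureTheory ProbabilityTheory Filter Topology Asymptotics
open scoped ENNReal

universe u

noncomputable section

namespace EpsGreedy

/-! ### Contexts, observations, functions of an action and a context -/

/-- The context space `[0,1]^d`, with its Borel (product) sigma-algebra. -/
abbrev Ctx (d : ℕ) : Type := Fin d → unitInterval

/-- Real functions `f(a, w)` of an action `a ∈ [K]` and a context `w` (regressors, policies). -/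
abbrev ActFun (d K : ℕ) : Type := Fin K × Ctx d → ℝ

/-- Observations `o = ((a, w), y)`: action, context and reward in `{0, 1}`. -/
abbrev Obs (d K : ℕ) : Type := (Fin K × Ctx d) × Fin 2

variable {d K : ℕ}

/-- The uniform reference design `g_ref(a, w) = 1 / K`. -/
def gref : ActFun d K := fun _ => (K : ℝ)⁻¹

/-- A policy: for each context, a probability vector over the actions. -/
def IsPolicy (π : ActFun d K) : Prop :=
  (∀ x, 0 ≤ π x) ∧ ∀ w, ∑ a, π (a, w) = 1

/-! ### The two variants: direct policy optimization and hinge-risk optimization -/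

/-- `direct`: direct policy optimization; `hinge`: hinge-risk optimization. -/
inductive Variant
  | direct
  | hinge

/-- The surrogate: `x ↦ x`, respectively `x ↦ max (0, 1 + x)`. -/
def Variant.phi : Variant → ℝ → ℝ
  | .direct => fun x => x
  | .hinge => fun x => max 0 (1 + x)

/-- The regressor class derived from a class `F₀` of functions of the context: all components lie
in `F₀`, and the vector of components lies in the simplex (direct) or sums to zero (hinge). -/
def Variant.regressors (v : Variant) (F₀ : Set (Ctx d → ℝ)) : Set (ActFun d K) :=
  match v with
  | .direct => {f | (∀ a, (fun w => f (a, w)) ∈ F₀) ∧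
      ∀ w, (fun a => f (a, w)) ∈ stdSimplex ℝ (Fin K)}
  | .hinge => {f | (∀ a, (fun w => f (a, w)) ∈ F₀) ∧ ∀ w, ∑ a, f (a, w) = 0}

/-- `π` is the policy attached to the regressor `f`: `f` itself (direct), or the policy that plays
a maximizer of `a ↦ f(a, w)` (hinge), whatever the rule by which ties are broken. -/
def Variant.IsPolicyOf (v : Variant) (f π : ActFun d K) : Prop :=
  match v with
  | .direct => π = f
  | .hinge => ∃ s : Ctx d → Fin K, (∀ a w, f (a, w) ≤ f (s w, w)) ∧
      ∀ a w, π (a, w) = if a = s w then 1 else 0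

/-! ### Losses and risks -/

/-- The loss `φ(f(a, w)) (1 - y)`. -/
def loss (φ : ℝ → ℝ) (f : ActFun d K) (o : Obs d K) : ℝ :=
  φ (f o.1) * (1 - ((o.2 : ℕ) : ℝ))

/-- The importance-sampling weighted loss `(g_ref(a, w) / g(a, w)) φ(f(a, w)) (1 - y)`. -/
def isLoss (φ : ℝ → ℝ) (g f : ActFun d K) (o : Obs d K) : ℝ :=
  gref o.1 / g o.1 * loss φ f o

/-- The joint law of `(A, W)` with `W ∼ ν` and, independently, `A` uniform on `[K]`. -/
def refDesign (K : ℕ) (ν : Measure (Ctx d)) : Measure (Fin K × Ctx d) :=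
  (uniformOn (Set.univ : Set (Fin K))).prod ν

/-- The law of the reference observation: `(A, W)` as above, `Y` given `(A, W)` drawn from `Q`. -/
def refLaw (ν : Measure (Ctx d)) (Q : Kernel (Fin K × Ctx d) (Fin 2)) : Measure (Obs d K) :=
  refDesign K ν ⊗ₘ Q

/-- The `φ`-risk of a regressor. -/
def risk (ν : Measure (Ctx d)) (Q : Kernel (Fin K × Ctx d) (Fin 2)) (φ : ℝ → ℝ)
    (f : ActFun d K) : ℝ :=
  ∫ o, loss φ f o ∂(refLaw ν Q)

/-- The importance-sampling weighted empirical `φ`-risk at time `t`, for the observations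
`O 1, …, O t` and the designs `g 1, …, g t`. -/
def empRisk (φ : ℝ → ℝ) (O : ℕ → Obs d K) (g : ℕ → ActFun d K) (t : ℕ) (f : ActFun d K) : ℝ :=
  (t : ℝ)⁻¹ * ∑ τ ∈ Finset.Icc 1 t, isLoss φ (g τ) f (O τ)

/-- `f` minimizes `R` over the class `F`. -/
def IsArgmin (R : ActFun d K → ℝ) (F : Set (ActFun d K)) (f : ActFun d K) : Prop :=
  f ∈ F ∧ IsMinOn R F f

/-! ### Bracketing numbers -/

/-- `n` brackets `[l, u]` with `‖u - l‖_{L_r(μ)} ≤ ε` cover `F`. -/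
def CoveredByBrackets {X : Type*} [MeasurableSpace X] (μ : Measure X) (r : ℝ≥0∞)
    (F : Set (X → ℝ)) (ε : ℝ) (n : ℕ) : Prop :=
  ∃ l u : Fin n → X → ℝ,
    (∀ i, Measurable (l i) ∧ Measurable (u i) ∧
      eLpNorm (fun x => u i x - l i x) r μ ≤ ENNReal.ofReal ε) ∧
    ∀ f ∈ F, ∃ i, ∀ x, l i x ≤ f x ∧ f x ≤ u i x

/-- The bracketing number `N_[](ε, F, L_r(μ))`; it is `⊤` if no finite cover exists. -/
def bracketingNumber {X : Type*} [MeasurableSpace X] (μ : Measure X) (r : ℝ≥0∞)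
    (F : Set (X → ℝ)) (ε : ℝ) : ℕ∞ :=
  ⨅ (n : ℕ) (_ : CoveredByBrackets μ r F ε n), (n : ℕ∞)

/-- `log (1 + N_[](ε, F, L_r(μ))) = O(ε^{-p})` as `ε → 0+`; in particular the bracketing
numbers are finite. -/
def HasBracketingEntropyRate {X : Type*} [MeasurableSpace X] (μ : Measure X) (r : ℝ≥0∞)
    (F : Set (X → ℝ)) (p : ℝ) : Prop :=
  (∀ᶠ ε in 𝓝[>] (0 : ℝ), bracketingNumber μ r F ε ≠ ⊤) ∧
  (fun ε : ℝ => Real.log (1 + ((bracketingNumber μ r F ε).toNat : ℝ)))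
    =O[𝓝[>] (0 : ℝ)] fun ε : ℝ => ε ^ (-p)

/-! ### The contextual bandit process -/

variable {Ω : Type*}

/-- The sigma-algebra `F_t` generated by the observations at times `1, …, t`. -/
@[reducible] def history (O : ℕ → Ω → Obs d K) (t : ℕ) : MeasurableSpace Ω :=
  ⨆ s ∈ Set.Icc 1 t, MeasurableSpace.comap (O s) inferInstance

/-- The observations `O 1, O 2, …` are those of a contextual bandit with context law `ν` and reward
kernel `Q`, where the learner carries out the random policy `g t` at each time `t ≥ 1`
(the values at time `0` play no role). -/
structure IsBanditProcess [MeasurableSpace Ω] (ν : Measure (Ctx d))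
    (Q : Kernel (Fin K × Ctx d) (Fin 2)) (P : Measure Ω)
    (O : ℕ → Ω → Obs d K) (g : ℕ → Ω → ActFun d K) : Prop where
  measurable_obs : ∀ n, Measurable (O (n + 1))
  /-- each design is a policy -/
  isPolicy : ∀ n ω, IsPolicy (g (n + 1) ω)
  /-- the design at time `n + 1` is a measurable function of the observations up to time `n` -/
  predictable : ∀ n, Measurable[(history O n).prod inferInstance]
    (fun z : Ω × (Fin K × Ctx d) => g (n + 1) z.1 z.2)
  /-- each context has law `ν` -/
  context_law : ∀ n, P.map (fun ω => (O (n + 1) ω).1.2) = ν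
  /-- each context is independent of the past -/
  context_indep : ∀ n, Indep
    (MeasurableSpace.comap (fun ω => (O (n + 1) ω).1.2) inferInstance) (history O n) P
  /-- given the past and the current context, the action is drawn from the current design -/
  action_law : ∀ n (a : Fin K),
    P[Set.indicator {ω | (O (n + 1) ω).1.1 = a} (fun _ => (1 : ℝ)) |
      history O n ⊔ MeasurableSpace.comap (fun ω => (O (n + 1) ω).1.2) inferInstance]
    =ᵐ[P] fun ω => g (n + 1) ω (a, (O (n + 1) ω).1.2)
  /-- given the past, the current context and the current action, the reward is drawn from `Q` -/
  reward_law : ∀ n (y : Fin 2),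
    P[Set.indicator {ω | (O (n + 1) ω).2 = y} (fun _ => (1 : ℝ)) |
      history O n ⊔ MeasurableSpace.comap (fun ω => (O (n + 1) ω).1) inferInstance]
    =ᵐ[P] fun ω => (Q (O (n + 1) ω).1).real {y}

/-- A run of the `ε`-greedy algorithm with exploration rates `δ t`, empirical risk minimizers
`fhat t` and greedy policies `pihat t`. -/
structure IsEpsGreedyRun [MeasurableSpace Ω] (v : Variant) (F₀ : Set (Ctx d → ℝ)) (δ : ℕ → ℝ)
    (ν : Measure (Ctx d)) (Q : Kernel (Fin K × Ctx d) (Fin 2)) (P : Measure Ω)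
    (O : ℕ → Ω → Obs d K) (g fhat pihat : ℕ → Ω → ActFun d K) : Prop where
  process : IsBanditProcess ν Q P O g
  rate_mem : ∀ n, δ (n + 1) ∈ Set.Icc (0 : ℝ) 1
  init : ∀ᵐ ω ∂P, pihat 0 ω = gref
  design : ∀ n, ∀ᵐ ω ∂P,
    g (n + 1) ω = fun x => δ (n + 1) * gref x + (1 - δ (n + 1)) * pihat n ω x
  fit : ∀ n, ∀ᵐ ω ∂P, IsArgmin
    (empRisk v.phi (fun τ => O τ ω) (fun τ => g τ ω) (n + 1)) (v.regressors F₀) (fhat (n + 1) ω)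
  greedy : ∀ n, ∀ᵐ ω ∂P, v.IsPolicyOf (fhat (n + 1) ω) (pihat (n + 1) ω)

end EpsGreedy

end

/-! Since `p < 1`, the exponent is `1/2`, so the claim is a parametric-type rate `(δ t) ^ (-1/2)`
with an explicit constant. Let `h = φ ∘ fhat - φ ∘ fstar`. By minimality of `fhat` the weighted
empirical mean of `h` is nonpositive, so the excess risk is at most the deviation (risk minus
empirical risk) of `h`. It suffices to bound this deviation from above, uniformly over the class of
all such `h`, outside an event that does not involve `fhat`; measurability of `fhat` is then
irrelevant.

For a fixed `h`, importance weighting makes each conditional mean equal to the reference mean, and a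
weight is at most `1/δ`, so the conditional second moment is at most `1/δ` times the squared `L²`
norm under the reference design. An exponential supermartingale then gives a Bernstein-type tail
(`measure_deviation_le`).

Uniformity comes from chaining over lower brackets at scales `ε₀ / 2^j` (`LowerChain.exists_event`).
One-sidedness is what makes this simple: passing from `h` to a lower bracket only decreases the
empirical risk, and costs at most the bracket width in risk. The chain stops at `2^J ≈ √(δ t)`,
where that width is of the target order; up to that level the links stay within the range of the
tail bound. The links contribute a series of order `∑ (H j + j) / 2^j` with `H j` of order `2^(p
j)`, which converges because `p < 1`. -/

namespace EpsGreedy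

/-! ### Change of measure: weighted means given the past equal means under the reference law. -/

section BanditIdentities

/-- The tower property with a bounded known factor pulled out; it turns the conditional laws of
action and reward into identities between integrals. -/
lemma integral_mul_congr_of_condExp {Ω : Type*} {m m0 : MeasurableSpace Ω} {P : Measure Ω}
    [IsFiniteMeasure P] (hm : m ≤ m0) {X f f' : Ω → ℝ} {C : ℝ} (hX : Measurable[m] X)
    (hXb : ∀ᵐ ω ∂P, |X ω| ≤ C) (hf : Integrable f P) (h : P[f | m] =ᵐ[P] f') :
    ∫ ω, X ω * f ω ∂P = ∫ ω, X ω * f' ω ∂P := by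
  have hXf : Integrable (X * f) P :=
    hf.bdd_mul (hX.mono hm le_rfl).aestronglyMeasurable hXb
  have h1 := condExp_mul_of_stronglyMeasurable_left (Measurable.stronglyMeasurable hX) hXf hf
  calc ∫ ω, X ω * f ω ∂P = ∫ ω, (P[X * f | m]) ω ∂P := (integral_condExp hm).symm
    _ = ∫ ω, X ω * f' ω ∂P := by
      refine integral_congr_ae ?_
      filter_upwards [h1, h] with ω h1 h
      rw [h1, Pi.mul_apply, h]

/-- The past and the current context. -/
@[reducible] def contextPast {d K : ℕ} {Ω : Type*} (O : ℕ → Ω → Obs d K) (n : ℕ) :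
    MeasurableSpace Ω :=
  history O n ⊔ MeasurableSpace.comap (fun ω => (O (n + 1) ω).1.2) inferInstance

/-- The past, the current context and the current action. -/
@[reducible] def actionPast {d K : ℕ} {Ω : Type*} (O : ℕ → Ω → Obs d K) (n : ℕ) :
    MeasurableSpace Ω :=
  history O n ⊔ MeasurableSpace.comap (fun ω => (O (n + 1) ω).1) inferInstance

lemma history_mono {d K : ℕ} {Ω : Type*} (O : ℕ → Ω → Obs d K) {m n : ℕ}
    (h : m ≤ n) : history O m ≤ history O n :=
  biSup_mono fun _ hs => ⟨hs.1, hs.2.trans h⟩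

lemma measurable_obs_history {d K : ℕ} {Ω : Type*} (O : ℕ → Ω → Obs d K) {m n : ℕ}
    (hm : 1 ≤ m) (h : m ≤ n) :
    Measurable[history O n] (O m) :=
  Measurable.of_comap_le (le_iSup₂_of_le m ⟨hm, h⟩ le_rfl)

variable {d K : ℕ} {Ω : Type*} [MeasurableSpace Ω] {ν : Measure (Ctx d)}
  {Q : Kernel (Fin K × Ctx d) (Fin 2)} {P : Measure Ω}
  {O : ℕ → Ω → Obs d K} {g : ℕ → Ω → ActFun d K}

lemma IsBanditProcess.history_le (hp : IsBanditProcess ν Q P O g) (n : ℕ) :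
    history O n ≤ ‹MeasurableSpace Ω› := by
  refine iSup₂_le fun s hs => ?_
  obtain ⟨k, rfl⟩ : ∃ k, s = k + 1 := ⟨s - 1, by have := hs.1; omega⟩
  exact (hp.measurable_obs k).comap_le

/-- A random policy evaluated at a random point is measurable. -/
lemma measurable_design_comp {d K : ℕ} {Ω : Type*} {m m' : MeasurableSpace Ω}
    {h : Ω → ActFun d K}
    (hh : Measurable[m'.prod inferInstance] (fun z : Ω × (Fin K × Ctx d) => h z.1 z.2))
    (hm : m' ≤ m) {X : Ω → Fin K × Ctx d}
    (hX : Measurable[m] X) : Measurable[m] (fun ω => h ω (X ω)) := by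
  have h2 : @Measurable _ _ m (m'.prod inferInstance) (fun ω => (ω, X ω)) :=
    @Measurable.prodMk _ m _ _ m' _ _ _ (measurable_id'' hm) hX
  exact hh.comp h2

lemma integral_refDesign [IsProbabilityMeasure ν] [NeZero K] {k : Fin K × Ctx d → ℝ}
    (hk : Integrable k (refDesign K ν)) :
    ∫ x, k x ∂(refDesign K ν) = ∑ a, (K : ℝ)⁻¹ * ∫ w, k (a, w) ∂ν := by
  unfold refDesign at hk ⊢
  rw [integral_prod _ hk, integral_fintype (Integrable.of_finite)]
  refine Finset.sum_congr rfl fun a _ => ?_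
  simp [Measure.real, uniformOn_univ]

instance [IsProbabilityMeasure ν] [NeZero K] : IsProbabilityMeasure (refDesign K ν) := by
  unfold refDesign; infer_instance

instance [IsProbabilityMeasure ν] [NeZero K] [IsMarkovKernel Q] :
    IsProbabilityMeasure (refLaw ν Q) := by
  unfold refLaw; infer_instance

lemma integral_refLaw [IsProbabilityMeasure ν] [NeZero K] [IsMarkovKernel Q] {k : Obs d K → ℝ}
    (hk : Integrable k (refLaw ν Q)) :
    ∫ o, k o ∂(refLaw ν Q) = ∫ x, ∑ y, (Q x).real {y} * k (x, y) ∂(refDesign K ν) := by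
  unfold refLaw at hk ⊢
  rw [Measure.integral_compProd hk]
  refine integral_congr_ae (.of_forall fun x => ?_)
  simp only
  rw [integral_fintype (Integrable.of_finite)]
  simp

lemma abs_kernel_real_le [IsMarkovKernel Q] (x : Fin K × Ctx d) (s : Set (Fin 2)) :
    |(Q x).real s| ≤ 1 := by
  rw [abs_of_nonneg measureReal_nonneg]
  exact measureReal_le_one

lemma measurable_kernel_real (y : Fin 2) : Measurable fun x => (Q x).real {y} :=
  (Q.measurable_coe (measurableSet_singleton y)).ennreal_toReal

variable [IsProbabilityMeasure P]

lemma integrable_of_bdd {X : Ω → ℝ} (hX : AEStronglyMeasurable X P) {C : ℝ}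
    (h : ∀ᵐ ω ∂P, |X ω| ≤ C) : Integrable X P :=
  Integrable.of_bound hX C h

/-- Importance weighting one action and one reward against the past. -/
lemma IsBanditProcess.integral_indicator [IsMarkovKernel Q] [NeZero K]
    (hp : IsBanditProcess ν Q P O g) (n : ℕ) {δ : ℝ} (hδ : 0 < δ)
    (hg : ∀ᵐ ω ∂P, ∀ a, δ ≤ g (n + 1) ω (a, (O (n + 1) ω).1.2))
    {G : Ω → ℝ} (hG : Measurable[history O n] G) {C : ℝ} (hGC : ∀ᵐ ω ∂P, |G ω| ≤ C)
    (a : Fin K) (y : Fin 2) {k : Ctx d → ℝ} (hk : Measurable k) {b : ℝ} (hkb : ∀ w, |k w| ≤ b) :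
    ∫ ω, G ω * ((K : ℝ)⁻¹ / g (n + 1) ω (a, (O (n + 1) ω).1.2) * k (O (n + 1) ω).1.2) *
        {ω | (O (n + 1) ω).1.1 = a}.indicator (fun _ => (1 : ℝ)) ω *
        {ω | (O (n + 1) ω).2 = y}.indicator (fun _ => (1 : ℝ)) ω ∂P
      = (∫ ω, G ω ∂P) * ((K : ℝ)⁻¹ * ∫ w, (Q (a, w)).real {y} * k w ∂ν) := by
  have hle := hp.history_le n
  have hO := hp.measurable_obs n
  have hK : (0 : ℝ) < K := by exact_mod_cast NeZero.pos K
  have hb0 : 0 ≤ b := (abs_nonneg _).trans (hkb fun _ => 0)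
  have hC0 : 0 ≤ C := by
    obtain ⟨ω, hω⟩ := hGC.exists
    exact (abs_nonneg _).trans hω
  set W : Ω → Ctx d := fun ω => (O (n + 1) ω).1.2 with hW
  have hWm : Measurable W := measurable_snd.comp (measurable_fst.comp hO)
  have hA : MeasurableSet {ω | (O (n + 1) ω).1.1 = a} :=
    (measurable_fst.comp (measurable_fst.comp hO)) (measurableSet_singleton a)
  have hY : MeasurableSet {ω | (O (n + 1) ω).2 = y} :=
    (measurable_snd.comp hO) (measurableSet_singleton y)
  have hm1le : contextPast O n ≤ ‹MeasurableSpace Ω› :=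
    sup_le hle hWm.comap_le
  have hm2le : actionPast O n ≤
      ‹MeasurableSpace Ω› := sup_le hle (measurable_fst.comp hO).comap_le
  have hGm : Measurable G := hG.mono hle le_rfl
  have hAi := (integrable_const (μ := P) (1 : ℝ)).indicator hA
  have hYi := (integrable_const (μ := P) (1 : ℝ)).indicator hY
  have hQm : Measurable fun w => (Q (a, w)).real {y} :=
    (measurable_kernel_real y).comp (measurable_const.prodMk measurable_id)
  have hψ : Measurable fun w => (K : ℝ)⁻¹ * ((Q (a, w)).real {y} * k w) :=
    measurable_const.mul (hQm.mul hk)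
  -- Once reward and action are integrated out, only a function of the fresh context remains, and it
  -- is independent of the past.
  have hindep : IndepFun G (fun ω => (K : ℝ)⁻¹ * ((Q (a, W ω)).real {y} * k (W ω))) P := by
    rw [IndepFun_iff_Indep]
    refine indep_of_indep_of_le_left (indep_of_indep_of_le_right (hp.context_indep n).symm ?_)
      (Measurable.comap_le hG)
    exact Measurable.comap_le (hψ.comp (Measurable.of_comap_le le_rfl))
  have hfin : ∫ ω, G ω * ((K : ℝ)⁻¹ * ((Q (a, W ω)).real {y} * k (W ω))) ∂P =
      (∫ ω, G ω ∂P) * ((K : ℝ)⁻¹ * ∫ w, (Q (a, w)).real {y} * k w ∂ν) := by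
    rw [hindep.integral_fun_mul_eq_mul_integral hGm.aestronglyMeasurable
      (hψ.comp hWm).aestronglyMeasurable]
    congr 1
    rw [← integral_const_mul, ← hp.context_law n]
    rw [integral_map hWm.aemeasurable hψ.aestronglyMeasurable]
  have hAW2 : Measurable[actionPast O n] (fun ω => (O (n + 1) ω).1) :=
    Measurable.of_comap_le le_sup_right
  have hW1 : Measurable[contextPast O n] W := Measurable.of_comap_le le_sup_right
  have hm12 : contextPast O n ≤ actionPast O n :=
    sup_le le_sup_left (Measurable.comap_le (measurable_snd.comp hAW2))
  have hgm : Measurable[contextPast O n] (fun ω => g (n + 1) ω (a, W ω)) :=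
    measurable_design_comp (hp.predictable n) le_sup_left (measurable_const.prodMk hW1)
  have hG1 : Measurable[contextPast O n] G := hG.mono le_sup_left le_rfl
  have hX0 : Measurable[contextPast O n]
      (fun ω => G ω * ((K : ℝ)⁻¹ / g (n + 1) ω (a, W ω) * k (W ω))) :=
    hG1.mul ((measurable_const.div hgm).mul (hk.comp hW1))
  have hX0b : ∀ᵐ ω ∂P, |G ω * ((K : ℝ)⁻¹ / g (n + 1) ω (a, W ω) * k (W ω))|
      ≤ C * ((K : ℝ)⁻¹ / δ * b) := by
    filter_upwards [hGC, hg] with ω h1 h2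
    have h3 := h2 a
    have h4 : |(K : ℝ)⁻¹ / g (n + 1) ω (a, W ω)| ≤ (K : ℝ)⁻¹ / δ := by
      rw [abs_of_nonneg (by have := hδ.trans_le h3; positivity)]
      gcongr
    rw [abs_mul, abs_mul]
    gcongr
    exact hkb _
  have hA2 : MeasurableSet[actionPast O n] {ω | (O (n + 1) ω).1.1 = a} :=
    (measurable_fst.comp hAW2) (measurableSet_singleton a)
  have hind : ∀ (s : Set Ω) ω, |s.indicator (fun _ => (1 : ℝ)) ω| ≤ 1 := by
    intro s ω
    by_cases h : ω ∈ s <;> simp [h]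
  -- Condition on the action first: the indicator of the reward becomes its kernel probability.
  refine (integral_mul_congr_of_condExp (C := C * ((K : ℝ)⁻¹ / δ * b)) hm2le
    ((hX0.mono hm12 le_rfl).mul (measurable_const.indicator hA2)) ?_
    hYi (hp.reward_law n y)).trans ?_
  · filter_upwards [hX0b] with ω h
    rw [Pi.mul_apply, abs_mul]
    exact (mul_le_of_le_one_right (abs_nonneg _) (hind _ _)).trans h
  have e1 : ∀ ω, G ω * ((K : ℝ)⁻¹ / g (n + 1) ω (a, W ω) * k (W ω)) *
        {ω | (O (n + 1) ω).1.1 = a}.indicator (fun _ => (1 : ℝ)) ω *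
        (Q (O (n + 1) ω).1).real {y} =
      (G ω * ((K : ℝ)⁻¹ / g (n + 1) ω (a, W ω) * k (W ω)) * (Q (a, W ω)).real {y}) *
        {ω | (O (n + 1) ω).1.1 = a}.indicator (fun _ => (1 : ℝ)) ω := by
    intro ω
    by_cases h : (O (n + 1) ω).1.1 = a
    · have : (O (n + 1) ω).1 = (a, W ω) := Prod.ext h rfl
      rw [this]; ring
    · simp [h]
  refine (integral_congr_ae (.of_forall e1)).trans ?_
  -- Then condition on the context: the indicator of the action becomes the design, which cancels
  -- the denominator of the weight.
  refine (integral_mul_congr_of_condExp (C := C * ((K : ℝ)⁻¹ / δ * b)) hm1le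
    (hX0.mul (hQm.comp hW1)) ?_ hAi (hp.action_law n a)).trans ?_
  · filter_upwards [hX0b] with ω h
    rw [Pi.mul_apply, abs_mul]
    exact (mul_le_of_le_one_right (abs_nonneg _) (abs_kernel_real_le _ _)).trans h
  have e2 : ∫ ω, G ω * ((K : ℝ)⁻¹ / g (n + 1) ω (a, W ω) * k (W ω)) * (Q (a, W ω)).real {y} *
      g (n + 1) ω (a, (O (n + 1) ω).1.2) ∂P =
      ∫ ω, G ω * ((K : ℝ)⁻¹ * ((Q (a, W ω)).real {y} * k (W ω))) ∂P := by
    refine integral_congr_ae ?_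
    filter_upwards [hg] with ω h
    have h3 : g (n + 1) ω (a, W ω) ≠ 0 := (hδ.trans_le (h a)).ne'
    change _ * g (n + 1) ω (a, W ω) = _
    field_simp
  refine e2.trans ?_
  exact hfin

/-- The importance weighted mean of a function of the next observation is its mean under the
reference law, independently of the past. -/
lemma IsBanditProcess.integral_weighted [IsProbabilityMeasure ν] [IsMarkovKernel Q] [NeZero K]
    (hp : IsBanditProcess ν Q P O g) (n : ℕ) {δ : ℝ} (hδ : 0 < δ)
    (hg : ∀ᵐ ω ∂P, ∀ a, δ ≤ g (n + 1) ω (a, (O (n + 1) ω).1.2))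
    {G : Ω → ℝ} (hG : Measurable[history O n] G) {C : ℝ} (hGC : ∀ᵐ ω ∂P, |G ω| ≤ C)
    {k : Obs d K → ℝ} (hk : Measurable k) {b : ℝ} (hkb : ∀ o, |k o| ≤ b) :
    ∫ ω, G ω * (gref (O (n + 1) ω).1 / g (n + 1) ω (O (n + 1) ω).1 * k (O (n + 1) ω)) ∂P
      = (∫ ω, G ω ∂P) * ∫ o, k o ∂(refLaw ν Q) := by
  have hle := hp.history_le n
  have hO := hp.measurable_obs n
  have hK : (0 : ℝ) < K := by exact_mod_cast NeZero.pos K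
  have hb0 : 0 ≤ b := (abs_nonneg _).trans (hkb ((0, fun _ => 0), 0))
  have hC0 : 0 ≤ C := by
    obtain ⟨ω, hω⟩ := hGC.exists
    exact (abs_nonneg _).trans hω
  have hWm : Measurable (fun ω => (O (n + 1) ω).1.2) :=
    measurable_snd.comp (measurable_fst.comp hO)
  have hkm : ∀ a y, Measurable fun w => k ((a, w), y) := fun a y =>
    hk.comp ((measurable_const.prodMk measurable_id).prodMk measurable_const)
  have hint : ∀ a y, Integrable (fun ω => G ω * ((K : ℝ)⁻¹ / g (n + 1) ω
      (a, (O (n + 1) ω).1.2) * k ((a, (O (n + 1) ω).1.2), y)) *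
        {ω | (O (n + 1) ω).1.1 = a}.indicator (fun _ => (1 : ℝ)) ω *
        {ω | (O (n + 1) ω).2 = y}.indicator (fun _ => (1 : ℝ)) ω) P := by
    intro a y
    have hind : ∀ (s : Set Ω) ω, |s.indicator (fun _ => (1 : ℝ)) ω| ≤ 1 := by
      intro s ω
      by_cases h : ω ∈ s <;> simp [h]
    refine integrable_of_bdd (C := C * ((K : ℝ)⁻¹ / δ * b)) ?_ ?_
    · have h1 := measurable_design_comp (hp.predictable n) hle (measurable_const.prodMk hWm : Measurable
        fun ω => (a, (O (n + 1) ω).1.2))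
      have hA : MeasurableSet {ω | (O (n + 1) ω).1.1 = a} :=
        (measurable_fst.comp (measurable_fst.comp hO)) (measurableSet_singleton a)
      have hY : MeasurableSet {ω | (O (n + 1) ω).2 = y} :=
        (measurable_snd.comp hO) (measurableSet_singleton y)
      exact ((((hG.mono hle le_rfl).mul ((measurable_const.div h1).mul
        ((hkm a y).comp hWm))).mul (measurable_const.indicator hA)).mul
        (measurable_const.indicator hY)).aestronglyMeasurable
    · filter_upwards [hGC, hg] with ω h1 h2
      have h3 := h2 a
      have h4 : |(K : ℝ)⁻¹ / g (n + 1) ω (a, (O (n + 1) ω).1.2)| ≤ (K : ℝ)⁻¹ / δ := by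
        rw [abs_of_nonneg (by have := hδ.trans_le h3; positivity)]
        gcongr
      rw [abs_mul, abs_mul, abs_mul, abs_mul]
      refine (mul_le_of_le_one_right (by positivity) (hind _ _)).trans ?_
      refine (mul_le_of_le_one_right (by positivity) (hind _ _)).trans ?_
      gcongr
      exact hkb _
  -- Split over all pairs of action and reward; only the realized pair contributes.
  have e0 : ∀ ω, G ω * (gref (O (n + 1) ω).1 / g (n + 1) ω (O (n + 1) ω).1 * k (O (n + 1) ω)) =
      ∑ a, ∑ y, G ω * ((K : ℝ)⁻¹ / g (n + 1) ω (a, (O (n + 1) ω).1.2) *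
          k ((a, (O (n + 1) ω).1.2), y)) *
        {ω | (O (n + 1) ω).1.1 = a}.indicator (fun _ => (1 : ℝ)) ω *
        {ω | (O (n + 1) ω).2 = y}.indicator (fun _ => (1 : ℝ)) ω := by
    intro ω
    rw [Finset.sum_eq_single (O (n + 1) ω).1.1, Finset.sum_eq_single (O (n + 1) ω).2]
    · simp [gref]
    · intro y _ hy
      simp [hy.symm]
    · simp
    · intro a _ ha
      simp [ha.symm]
    · simp
  simp_rw [e0]
  rw [integral_finsetSum _ fun a _ => integrable_finsetSum _ fun y _ => hint a y]
  have hki : Integrable k (refLaw ν Q) :=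
    integrable_of_bdd hk.aestronglyMeasurable (.of_forall hkb)
  have hbd : ∀ x y, |(Q x).real {y} * k (x, y)| ≤ b := fun x y => by
    rw [abs_mul]
    exact (mul_le_of_le_one_left (abs_nonneg _) (abs_kernel_real_le _ _)).trans (hkb _)
  have hQk : ∀ y, Measurable fun x => (Q x).real {y} * k (x, y) := fun y =>
    (measurable_kernel_real y).mul (hk.comp (measurable_id.prodMk measurable_const))
  rw [integral_refLaw hki, integral_refDesign, Finset.mul_sum]
  swap
  · exact integrable_finsetSum _ fun y _ =>
      integrable_of_bdd (hQk y).aestronglyMeasurable (.of_forall fun x => hbd x y)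
  refine Finset.sum_congr rfl fun a _ => ?_
  have hi : ∀ y, Integrable (fun w => (Q (a, w)).real {y} * k ((a, w), y)) ν := fun y =>
    integrable_of_bdd ((hQk y).comp (measurable_const.prodMk measurable_id)).aestronglyMeasurable
      (.of_forall fun x => hbd _ y)
  rw [integral_finsetSum _ fun y _ => hi y, Finset.mul_sum, Finset.mul_sum,
    integral_finsetSum _ fun y _ => hint a y]
  exact Finset.sum_congr rfl fun y _ => hp.integral_indicator n hδ hg hG hGC a y (hkm a y)
      fun w => hkb _

end BanditIdentities

/-! ### Exponential supermartingale and tail bound for a single function. -/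

section Deviation

lemma one_sub_reward_mem (y : Fin 2) : 0 ≤ 1 - ((y : ℕ) : ℝ) ∧ 1 - ((y : ℕ) : ℝ) ≤ 1 := by
  fin_cases y <;> simp

variable {d K : ℕ}

lemma gref_div_nonneg {π : ActFun d K} {x : Fin K × Ctx d} (hπ : 0 ≤ π x) :
    0 ≤ gref x / π x := by
  unfold gref; positivity

lemma gref_div_le [NeZero K] {δ : ℝ} (hδ : 0 < δ) {π : ActFun d K} {x : Fin K × Ctx d}
    (hπ : δ ≤ π x) : gref x / π x ≤ δ⁻¹ := by
  have hK : (1 : ℝ) ≤ K := by exact_mod_cast NeZero.one_le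
  unfold gref
  rw [div_eq_mul_inv]
  calc (K : ℝ)⁻¹ * (π x)⁻¹ ≤ 1 * δ⁻¹ := by
        have hπ0 := hδ.trans_le hπ
        gcongr
        exact inv_le_one_of_one_le₀ hK
    _ = δ⁻¹ := one_mul _

lemma abs_loss_id_le {h : ActFun d K} {b : ℝ} (hb : ∀ x, |h x| ≤ b) (o : Obs d K) :
    |loss id h o| ≤ b := by
  obtain ⟨h0, h1⟩ := one_sub_reward_mem o.2
  rw [loss, id, abs_mul, abs_of_nonneg h0]
  exact (mul_le_of_le_one_right (abs_nonneg _) h1).trans (hb _)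

lemma measurable_loss_id {h : ActFun d K} (hh : Measurable h) : Measurable (loss (K := K) id h) :=
  (hh.comp measurable_fst).mul (measurable_const.sub
    ((measurable_of_finite fun y : Fin 2 => ((y : ℕ) : ℝ)).comp measurable_snd))

lemma abs_isLoss_id_le [NeZero K] {δ : ℝ} (hδ : 0 < δ) {π h : ActFun d K} {b : ℝ}
    (hb : ∀ x, |h x| ≤ b) {o : Obs d K} (hπ : δ ≤ π o.1) : |isLoss id π h o| ≤ δ⁻¹ * b := by
  have h0 : 0 ≤ gref o.1 / π o.1 := gref_div_nonneg (hδ.le.trans hπ)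
  rw [isLoss, abs_mul, abs_of_nonneg h0]
  exact mul_le_mul (gref_div_le hδ hπ) (abs_loss_id_le hb o) (abs_nonneg _) (by positivity)

variable {Ω : Type*} [MeasurableSpace Ω]
  {P : Measure Ω} {ν : Measure (Ctx d)} {Q : Kernel (Fin K × Ctx d) (Fin 2)}
  {O : ℕ → Ω → Obs d K} {g : ℕ → Ω → ActFun d K}

lemma IsBanditProcess.measurable_isLoss (hp : IsBanditProcess ν Q P O g) (n : ℕ)
    {h : ActFun d K} (hh : Measurable h) :
    Measurable[history O (n + 1)] fun ω => isLoss id (g (n + 1) ω) h (O (n + 1) ω) := by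
  have hO : Measurable[history O (n + 1)] (O (n + 1)) :=
    measurable_obs_history O (Nat.le_add_left 1 n) le_rfl
  have h1 : Measurable[history O (n + 1)] fun ω => g (n + 1) ω (O (n + 1) ω).1 :=
    measurable_design_comp (hp.predictable n) (history_mono O (Nat.le_succ n))
      (measurable_fst.comp hO)
  have h2 : Measurable[history O (n + 1)] fun ω => loss id h (O (n + 1) ω) :=
    (measurable_loss_id hh).comp hO
  unfold isLoss
  exact (measurable_const.div h1).mul h2

variable [IsProbabilityMeasure ν] [IsMarkovKernel Q]

lemma integral_refLaw_fst {k : Fin K × Ctx d → ℝ} (hk : Measurable k) :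
    ∫ o, k o.1 ∂(refLaw ν Q) = ∫ x, k x ∂(refDesign K ν) := by
  have h : (refLaw ν Q).map Prod.fst = refDesign K ν := by
    unfold refLaw refDesign
    exact Measure.fst_compProd _ _
  rw [← h, integral_map measurable_fst.aemeasurable hk.aestronglyMeasurable]

variable [IsProbabilityMeasure P]

/-- One step of the exponential supermartingale. -/
lemma IsBanditProcess.integral_mul_exp_le [NeZero K] (hp : IsBanditProcess ν Q P O g) (n : ℕ)
    {δ : ℝ} (hδ : 0 < δ) (hg : ∀ᵐ ω ∂P, ∀ a, δ ≤ g (n + 1) ω (a, (O (n + 1) ω).1.2))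
    {G : Ω → ℝ} (hG : Measurable[history O n] G) {C : ℝ} (hG0 : ∀ ω, 0 ≤ G ω)
    (hGC : ∀ᵐ ω ∂P, |G ω| ≤ C)
    {h : ActFun d K} (hh : Measurable h) {b V : ℝ} (hb : ∀ x, |h x| ≤ b)
    (hV : ∫ x, h x ^ 2 ∂(refDesign K ν) ≤ V) {l : ℝ} (hl : 0 ≤ l) (hlb : l * b ≤ δ) :
    ∫ ω, G ω * Real.exp (-(l * isLoss id (g (n + 1) ω) h (O (n + 1) ω))) ∂P ≤
      (∫ ω, G ω ∂P) * Real.exp (-(l * risk ν Q id h) + l ^ 2 * V / δ) := by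
  have hGm : Measurable G := hG.mono (hp.history_le n) le_rfl
  have hGi : Integrable G P := integrable_of_bdd hGm.aestronglyMeasurable hGC
  have hb0 : 0 ≤ b := (abs_nonneg _).trans (hb (0, fun _ => 0))
  have hlZ : ∀ᵐ ω ∂P, |l * isLoss id (g (n + 1) ω) h (O (n + 1) ω)| ≤ 1 := by
    filter_upwards [hg] with ω hω
    rw [abs_mul, abs_of_nonneg hl]
    calc l * |isLoss id (g (n + 1) ω) h (O (n + 1) ω)| ≤ l * (δ⁻¹ * b) := by
          gcongr
          exact abs_isLoss_id_le hδ hb (hω _)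
      _ = δ⁻¹ * (l * b) := by ring
      _ ≤ δ⁻¹ * δ := by gcongr
      _ = 1 := inv_mul_cancel₀ hδ.ne'
  have hZm : Measurable fun ω => isLoss id (g (n + 1) ω) h (O (n + 1) ω) :=
    (hp.measurable_isLoss n hh).mono (hp.history_le _) le_rfl
  -- Chosen so that the exponential factor is at most one plus the weight times `k`: the linear term
  -- of the expansion carries one weight, and the quadratic term carries two, of which one is
  -- bounded by `1/δ`. A single use of `integral_weighted` then handles both terms.
  set k : Obs d K → ℝ := fun o => -(l * loss id h o) + l ^ 2 / δ * h o.1 ^ 2 with hk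
  have hkm : Measurable k :=
    (measurable_const.mul (measurable_loss_id hh)).neg.add
      (measurable_const.mul ((hh.comp measurable_fst).pow_const 2))
  have hsq : ∀ x, |h x ^ 2| ≤ b ^ 2 := fun x => by
    rw [abs_pow]; exact pow_le_pow_left₀ (abs_nonneg _) (hb x) 2
  have hkb : ∀ o, |k o| ≤ l * b + l ^ 2 / δ * b ^ 2 := fun o => by
    refine (abs_add_le _ _).trans ?_
    rw [abs_neg, abs_mul, abs_mul, abs_of_nonneg hl, abs_of_nonneg (by positivity : 0 ≤ l ^ 2 / δ)]
    gcongr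
    · exact abs_loss_id_le hb o
    · exact hsq _
  have hint : ∫ o, k o ∂(refLaw ν Q) ≤ -(l * risk ν Q id h) + l ^ 2 * V / δ := by
    have i1 : Integrable (fun o => -(l * loss id h o)) (refLaw ν Q) :=
      ((integrable_of_bdd (measurable_loss_id hh).aestronglyMeasurable
        (.of_forall (abs_loss_id_le hb))).const_mul l).neg
    have i2 : Integrable (fun o : Obs d K => l ^ 2 / δ * h o.1 ^ 2) (refLaw ν Q) :=
      (integrable_of_bdd ((hh.comp measurable_fst).pow_const 2).aestronglyMeasurable
        (.of_forall fun o => hsq o.1)).const_mul _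
    rw [hk, integral_add i1 i2, integral_neg, integral_const_mul, integral_const_mul,
      integral_refLaw_fst (k := fun x => h x ^ 2) (hh.pow_const 2), risk]
    have : l ^ 2 / δ * ∫ x, h x ^ 2 ∂(refDesign K ν) ≤ l ^ 2 / δ * V := by gcongr
    linarith [show l ^ 2 / δ * V = l ^ 2 * V / δ by ring]
  have hw : Integrable (fun ω => G ω * (gref (O (n + 1) ω).1 / g (n + 1) ω (O (n + 1) ω).1 *
      k (O (n + 1) ω))) P := by
    refine hGi.mul_bdd (c := δ⁻¹ * (l * b + l ^ 2 / δ * b ^ 2)) ?_ ?_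
    · have h1 : Measurable fun ω => g (n + 1) ω (O (n + 1) ω).1 :=
        measurable_design_comp (hp.predictable n) (hp.history_le n)
          (measurable_fst.comp (hp.measurable_obs n))
      exact ((measurable_const.div h1).mul (hkm.comp (hp.measurable_obs n))).aestronglyMeasurable
    · filter_upwards [hg] with ω hω
      have h0 := gref_div_nonneg (hδ.le.trans (hω (O (n + 1) ω).1.1))
      rw [Real.norm_eq_abs, abs_mul, abs_of_nonneg h0]
      exact mul_le_mul (gref_div_le hδ (hω _)) (hkb _) (abs_nonneg _) (by positivity)
  calc ∫ ω, G ω * Real.exp (-(l * isLoss id (g (n + 1) ω) h (O (n + 1) ω))) ∂P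
      ≤ ∫ ω, (G ω + G ω * (gref (O (n + 1) ω).1 / g (n + 1) ω (O (n + 1) ω).1 *
          k (O (n + 1) ω))) ∂P := by
        refine integral_mono_ae ?_ (hGi.add hw) ?_
        · refine hGi.mul_bdd (c := Real.exp 1) ?_ ?_
          · exact (measurable_const.mul hZm).neg.exp.aestronglyMeasurable
          · filter_upwards [hlZ] with ω hω
            rw [Real.norm_eq_abs, Real.abs_exp]
            exact Real.exp_le_exp.2 ((neg_le_abs _).trans hω)
        · filter_upwards [hlZ, hg] with ω hω hgω
          -- The bound `exp x ≤ 1 + x + x²` for `|x| ≤ 1`; the condition `l * b ≤ δ` is what keeps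
          -- the argument in this range.
          have h1 := Real.abs_exp_sub_one_sub_id_le (x := -(l * isLoss id (g (n + 1) ω) h
            (O (n + 1) ω))) (by rwa [abs_neg])
          have h2 := (abs_le.1 h1).2
          have h3 := gref_div_nonneg (hδ.le.trans (hgω (O (n + 1) ω).1.1))
          have h4 := gref_div_le hδ (hgω (O (n + 1) ω).1.1)
          obtain ⟨y0, y1⟩ := one_sub_reward_mem (O (n + 1) ω).2
          have h5 : isLoss id (g (n + 1) ω) h (O (n + 1) ω) ^ 2 ≤
              gref (O (n + 1) ω).1 / g (n + 1) ω (O (n + 1) ω).1 * (δ⁻¹ *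
                h (O (n + 1) ω).1 ^ 2) := by
            rw [isLoss, loss, id, mul_pow, mul_pow, pow_two (gref _ / _), mul_assoc]
            refine mul_le_mul_of_nonneg_left ?_ h3
            refine mul_le_mul h4 ?_ (by positivity) (by positivity)
            exact mul_le_of_le_one_right (by positivity) (pow_le_one₀ y0 y1)
          rw [show G ω + G ω * (gref (O (n + 1) ω).1 / g (n + 1) ω (O (n + 1) ω).1 *
            k (O (n + 1) ω)) = G ω * (1 + gref (O (n + 1) ω).1 / g (n + 1) ω (O (n + 1) ω).1 *
            k (O (n + 1) ω)) by ring]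
          refine mul_le_mul_of_nonneg_left ?_ (hG0 ω)
          have h6 : gref (O (n + 1) ω).1 / g (n + 1) ω (O (n + 1) ω).1 * k (O (n + 1) ω) =
              -(l * isLoss id (g (n + 1) ω) h (O (n + 1) ω)) +
              l ^ 2 * (gref (O (n + 1) ω).1 / g (n + 1) ω (O (n + 1) ω).1 * (δ⁻¹ *
                h (O (n + 1) ω).1 ^ 2)) := by
            simp only [hk, isLoss]; ring
          rw [h6]
          nlinarith [mul_le_mul_of_nonneg_left h5 (sq_nonneg l)]
    _ = (∫ ω, G ω ∂P) * (1 + ∫ o, k o ∂(refLaw ν Q)) := by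
        rw [integral_add hGi hw, hp.integral_weighted n hδ hg hG hGC hkm hkb]; ring
    _ ≤ _ := by
        refine mul_le_mul_of_nonneg_left ?_ (integral_nonneg hG0)
        have := Real.add_one_le_exp (∫ o, k o ∂(refLaw ν Q))
        exact (by linarith : 1 + ∫ o, k o ∂(refLaw ν Q) ≤ _).trans (Real.exp_le_exp.2 hint)

/-- Iterates the one-step bound. Measurability and boundedness are carried through the induction
because the exponential of the first `n` terms plays the role of the past factor `G` at step `n +
1`. -/
lemma IsBanditProcess.integral_exp_sum_le [NeZero K] (hp : IsBanditProcess ν Q P O g) (t : ℕ)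
    {δ : ℝ} (hδ : 0 < δ) (hg : ∀ τ ∈ Finset.Icc 1 t, ∀ᵐ ω ∂P, ∀ a, δ ≤ g τ ω (a, (O τ ω).1.2))
    {h : ActFun d K} (hh : Measurable h) {b V : ℝ} (hb : ∀ x, |h x| ≤ b)
    (hV : ∫ x, h x ^ 2 ∂(refDesign K ν) ≤ V) {l : ℝ} (hl : 0 ≤ l) (hlb : l * b ≤ δ) :
    Measurable[history O t] (fun ω => Real.exp (l * ∑ τ ∈ Finset.Icc 1 t,
      (risk ν Q id h - isLoss id (g τ ω) h (O τ ω)))) ∧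
    (∃ C, ∀ᵐ ω ∂P, |Real.exp (l * ∑ τ ∈ Finset.Icc 1 t,
      (risk ν Q id h - isLoss id (g τ ω) h (O τ ω)))| ≤ C) ∧
    ∫ ω, Real.exp (l * ∑ τ ∈ Finset.Icc 1 t,
      (risk ν Q id h - isLoss id (g τ ω) h (O τ ω))) ∂P ≤ Real.exp (t * (l ^ 2 * V / δ)) := by
  induction t with
  | zero =>
    refine ⟨by simp, ⟨1, by simp⟩, by simp⟩
  | succ n ih =>
    obtain ⟨h1, ⟨C, h2⟩, h3⟩ := ih fun τ hτ => hg τ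
      (Finset.Icc_subset_Icc_right (Nat.le_succ n) hτ)
    have hgn := hg (n + 1) (by simp)
    have e : ∀ ω, Real.exp (l * ∑ τ ∈ Finset.Icc 1 (n + 1),
        (risk ν Q id h - isLoss id (g τ ω) h (O τ ω))) =
        Real.exp (l * risk ν Q id h) * (Real.exp (l * ∑ τ ∈ Finset.Icc 1 n,
        (risk ν Q id h - isLoss id (g τ ω) h (O τ ω))) *
        Real.exp (-(l * isLoss id (g (n + 1) ω) h (O (n + 1) ω)))) := by
      intro ω
      rw [Finset.sum_Icc_succ_top (by omega), ← Real.exp_add, ← Real.exp_add]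
      congr 1; ring
    simp_rw [e]
    refine ⟨?_, ⟨Real.exp (l * risk ν Q id h) * (C * Real.exp (l * (δ⁻¹ * b))), ?_⟩, ?_⟩
    · exact measurable_const.mul ((h1.mono (history_mono O (Nat.le_succ n)) le_rfl).mul
        (measurable_const.mul (hp.measurable_isLoss n hh)).neg.exp)
    · filter_upwards [h2, hgn] with ω h2 hω
      rw [abs_mul, abs_mul, Real.abs_exp (l * risk ν Q id h),
        Real.abs_exp (-(l * isLoss id (g (n + 1) ω) h (O (n + 1) ω)))]
      have h4 := abs_isLoss_id_le hδ hb (hω (O (n + 1) ω).1.1)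
      have : -(l * isLoss id (g (n + 1) ω) h (O (n + 1) ω)) ≤ l * (δ⁻¹ * b) := by
        rw [← mul_neg]
        exact mul_le_mul_of_nonneg_left ((neg_le_abs _).trans h4) hl
      have hC : 0 ≤ C := (abs_nonneg _).trans h2
      gcongr
    · rw [integral_const_mul]
      have h4 := hp.integral_mul_exp_le n hδ hgn h1 (fun ω => (Real.exp_pos _).le) h2 hh hb hV hl
        hlb
      calc _ ≤ Real.exp (l * risk ν Q id h) * (Real.exp (n * (l ^ 2 * V / δ)) *
            Real.exp (-(l * risk ν Q id h) + l ^ 2 * V / δ)) := by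
            refine mul_le_mul_of_nonneg_left (h4.trans ?_) (Real.exp_pos _).le
            exact mul_le_mul_of_nonneg_right h3 (Real.exp_pos _).le
        _ = _ := by
            rw [← Real.exp_add, ← Real.exp_add]
            congr 1; push_cast; ring

/-- Bernstein-type tail bound for the deviation of an importance weighted average. -/
lemma IsBanditProcess.measure_deviation_le [NeZero K] (hp : IsBanditProcess ν Q P O g) {t : ℕ}
    (ht : 1 ≤ t) {δ : ℝ} (hδ : 0 < δ)
    (hg : ∀ τ ∈ Finset.Icc 1 t, ∀ᵐ ω ∂P, ∀ a, δ ≤ g τ ω (a, (O τ ω).1.2))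
    {h : ActFun d K} (hh : Measurable h) {b V : ℝ} (hb : ∀ x, |h x| ≤ b)
    (hV : ∫ x, h x ^ 2 ∂(refDesign K ν) ≤ V) {s : ℝ} (hs : 0 < s) (hsb : s * b ≤ 1) (v : ℝ) :
    P {ω | s * V + v / (δ * t * s) ≤ risk ν Q id h -
      empRisk id (fun τ => O τ ω) (fun τ => g τ ω) t h} ≤ ENNReal.ofReal (Real.exp (-v)) := by
  -- Chernoff bound with parameter `δ * s`: the moment bound `exp (δ t s² V)` cancels the `s * V`
  -- part of the threshold and leaves `exp (-v)`.
  obtain ⟨h1, ⟨C, h2⟩, h3⟩ := hp.integral_exp_sum_le t hδ hg hh hb hV (l := δ * s)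
    (by positivity) (by rw [mul_assoc]; exact mul_le_of_le_one_right hδ.le hsb)
  have ht0 : (0 : ℝ) < t := by exact_mod_cast ht
  have hm := mul_meas_ge_le_integral_of_nonneg (μ := P) (.of_forall fun ω => (Real.exp_pos _).le)
    (integrable_of_bdd (h1.mono (hp.history_le t) le_rfl).aestronglyMeasurable h2)
    (Real.exp (δ * s * (t * (s * V + v / (δ * t * s)))))
  have hsub : {ω | s * V + v / (δ * t * s) ≤ risk ν Q id h -
      empRisk id (fun τ => O τ ω) (fun τ => g τ ω) t h} ⊆
      {ω | Real.exp (δ * s * (t * (s * V + v / (δ * t * s)))) ≤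
        Real.exp (δ * s * ∑ τ ∈ Finset.Icc 1 t,
          (risk ν Q id h - isLoss id (g τ ω) h (O τ ω)))} := by
    intro ω hω
    simp only [Set.mem_ofPred_eq, empRisk] at hω ⊢
    rw [Real.exp_le_exp]
    refine mul_le_mul_of_nonneg_left ?_ (by positivity)
    rw [Finset.sum_sub_distrib, Finset.sum_const, Nat.card_Icc, nsmul_eq_mul]
    have h5 := mul_le_mul_of_nonneg_left hω ht0.le
    rw [mul_sub, mul_inv_cancel_left₀ ht0.ne'] at h5
    simpa using h5
  refine (measure_mono hsub).trans ?_
  rw [← ofReal_measureReal]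
  refine ENNReal.ofReal_le_ofReal ?_
  have h6 := hm.trans h3
  rw [← le_div_iff₀' (Real.exp_pos _), ← Real.exp_sub] at h6
  refine h6.trans (Real.exp_le_exp.2 (le_of_eq ?_))
  field_simp
  ring

end Deviation

/-! ### One-sided chaining along lower brackets. -/

section Chaining

variable {d K : ℕ}

/-- The excess of the risk of `h`, with the identity as surrogate, over its importance weighted
empirical counterpart. -/
noncomputable def deviation (ν : Measure (Ctx d)) (Q : Kernel (Fin K × Ctx d) (Fin 2))
    (O : ℕ → Obs d K) (g : ℕ → ActFun d K) (t : ℕ) (h : ActFun d K) : ℝ :=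
  risk ν Q id h - empRisk id O g t h

variable {ν : Measure (Ctx d)} [IsProbabilityMeasure ν] {Q : Kernel (Fin K × Ctx d) (Fin 2)}
  [IsMarkovKernel Q]

lemma integrable_loss_id [NeZero K] {h : ActFun d K} (hh : Measurable h) {b : ℝ}
    (hb : ∀ x, |h x| ≤ b) : Integrable (loss id h) (refLaw ν Q) :=
  integrable_of_bdd (measurable_loss_id hh).aestronglyMeasurable (.of_forall (abs_loss_id_le hb))

lemma risk_sub [NeZero K] {h k : ActFun d K} (hh : Measurable h) (hk : Measurable k) {b c : ℝ}
    (hb : ∀ x, |h x| ≤ b) (hc : ∀ x, |k x| ≤ c) :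
    risk ν Q id (h - k) = risk ν Q id h - risk ν Q id k := by
  unfold risk
  rw [← integral_sub (integrable_loss_id hh hb) (integrable_loss_id hk hc)]
  refine integral_congr_ae (.of_forall fun o => ?_)
  simp [loss, sub_mul]

omit [IsProbabilityMeasure ν] [IsMarkovKernel Q] in
lemma empRisk_sub (O : ℕ → Obs d K) (g : ℕ → ActFun d K) (t : ℕ) (h k : ActFun d K) :
    empRisk id O g t (h - k) = empRisk id O g t h - empRisk id O g t k := by
  unfold empRisk
  rw [← mul_sub, ← Finset.sum_sub_distrib]
  congr 1
  refine Finset.sum_congr rfl fun τ _ => ?_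
  simp only [isLoss, loss, id, Pi.sub_apply]
  ring

lemma deviation_sub [NeZero K] {h k : ActFun d K} (hh : Measurable h) (hk : Measurable k)
    {b c : ℝ} (hb : ∀ x, |h x| ≤ b) (hc : ∀ x, |k x| ≤ c) (O : ℕ → Obs d K)
    (g : ℕ → ActFun d K) (t : ℕ) :
    deviation ν Q O g t (h - k) = deviation ν Q O g t h - deviation ν Q O g t k := by
  unfold deviation
  rw [risk_sub hh hk hb hc, empRisk_sub]; ring

lemma empRisk_mono {O : ℕ → Obs d K} {g : ℕ → ActFun d K} {t : ℕ}
    (hg : ∀ τ ∈ Finset.Icc 1 t, ∀ x, 0 ≤ g τ x) {h k : ActFun d K} (hhk : ∀ x, h x ≤ k x) :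
    empRisk id O g t h ≤ empRisk id O g t k := by
  unfold empRisk isLoss loss
  refine mul_le_mul_of_nonneg_left (Finset.sum_le_sum fun τ hτ => ?_) (by positivity)
  refine mul_le_mul_of_nonneg_left ?_ (gref_div_nonneg (hg τ hτ _))
  exact mul_le_mul_of_nonneg_right (hhk _) (one_sub_reward_mem _).1

/-- The risk is controlled by the `L²` norm. -/
lemma risk_le_of_integral_sq_le [NeZero K] {h : ActFun d K} (hh : Measurable h) {b c : ℝ}
    (hb : ∀ x, |h x| ≤ b) (hc : 0 ≤ c) (h2 : ∫ x, h x ^ 2 ∂(refDesign K ν) ≤ c ^ 2) :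
    risk ν Q id h ≤ c := by
  have hi : Integrable (fun x => |h x|) (refDesign K ν) :=
    integrable_of_bdd hh.abs.aestronglyMeasurable (.of_forall fun x => by rw [abs_abs]; exact hb x)
  have h1 : risk ν Q id h ≤ ∫ x, |h x| ∂(refDesign K ν) := by
    rw [← integral_refLaw_fst (Q := Q) hh.abs, risk]
    refine integral_mono (integrable_loss_id hh hb) ?_ fun o => ?_
    · exact integrable_of_bdd (hh.abs.comp measurable_fst).aestronglyMeasurable
        (.of_forall fun o => by rw [abs_abs]; exact hb o.1)
    · obtain ⟨y0, y1⟩ := one_sub_reward_mem o.2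
      exact (mul_le_mul_of_nonneg_right (le_abs_self _) y0).trans
        (mul_le_of_le_one_right (abs_nonneg _) y1)
  -- Jensen's inequality, read off from the nonnegativity of the variance of `|h|`.
  have h3 : (∫ x, |h x| ∂(refDesign K ν)) ^ 2 ≤ ∫ x, h x ^ 2 ∂(refDesign K ν) := by
    have hm : MemLp (fun x => |h x|) 2 (refDesign K ν) :=
      MemLp.of_bound hh.abs.aestronglyMeasurable b
        (.of_forall fun x => by rw [Real.norm_eq_abs, abs_abs]; exact hb x)
    have := variance_eq_sub hm
    have h0 := variance_nonneg (fun x => |h x|) (refDesign K ν)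
    simp only [Pi.pow_apply, sq_abs] at this
    linarith
  exact h1.trans (abs_le_of_sq_le_sq' (h3.trans h2) hc).2

/-- Finite families of functions that approximate the members of `𝓗` from below, at the scales
`A / 2 ^ j`. -/
structure LowerChain (ν : Measure (Ctx d)) (𝓗 : Set (ActFun d K)) (A B : ℝ) (H : ℕ → ℝ) where
  card : ℕ → ℕ
  lower : ∀ j, Fin (card j) → ActFun d K
  measurable_lower : ∀ j i, Measurable (lower j i)
  abs_lower_le : ∀ j i x, |lower j i x| ≤ B
  card_le : ∀ j, (card j : ℝ) ≤ Real.exp (H j)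
  exists_lower : ∀ h ∈ 𝓗, ∀ j, ∃ i, (∀ x, lower j i x ≤ h x) ∧
    ∫ x, (h x - lower j i x) ^ 2 ∂(refDesign K ν) ≤ (A / 2 ^ j) ^ 2

/-- The contribution of the links between the levels `j` and `j + 1`. -/
noncomputable def linkConst (A B : ℝ) (H : ℕ → ℝ) (v : ℝ) (j : ℕ) : ℝ :=
  (2 * A ^ 2 / B + 2 * B * (H j + H (j + 1) + j + v)) / 2 ^ j

/-- The constant in the chaining bound. -/
noncomputable def chainConst (A B : ℝ) (H : ℕ → ℝ) (v : ℝ) : ℝ :=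
  B / 2 + 2 * B * (H 0 + v) + ∑' j, linkConst A B H v j + 2 * A

lemma measure_iUnion_le_exp {Ω ι : Type*} [MeasurableSpace Ω] {P : Measure Ω} [Fintype ι]
    {S : ι → Set Ω} {c v : ℝ} (hc : (Fintype.card ι : ℝ) ≤ Real.exp c)
    (hS : ∀ i, P (S i) ≤ ENNReal.ofReal (Real.exp (-(c + v)))) :
    P (⋃ i, S i) ≤ ENNReal.ofReal (Real.exp (-v)) := by
  calc P (⋃ i, S i) ≤ ∑ i, P (S i) := measure_iUnion_fintype_le _ _
    _ ≤ ∑ _i : ι, ENNReal.ofReal (Real.exp (-(c + v))) := Finset.sum_le_sum fun i _ => hS i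
    _ = ENNReal.ofReal (Fintype.card ι * Real.exp (-(c + v))) := by
        rw [Finset.sum_const, Finset.card_univ, nsmul_eq_mul, ENNReal.ofReal_mul (by positivity),
          ENNReal.ofReal_natCast]
    _ ≤ ENNReal.ofReal (Real.exp (-v)) := by
        refine ENNReal.ofReal_le_ofReal ?_
        calc _ ≤ Real.exp c * Real.exp (-(c + v)) := by gcongr
          _ = _ := by rw [← Real.exp_add]; congr 1; ring

/-- The extra `j` in the exponent at level `j` pays for the union over levels, since `exp (-j) ≤ 2 ^
(-j)`. -/
lemma sum_ofReal_exp_le (J : ℕ) (v : ℝ) :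
    ∑ j ∈ Finset.range J, ENNReal.ofReal (Real.exp (-((j : ℝ) + v))) ≤
      ENNReal.ofReal (2 * Real.exp (-v)) := by
  rw [← ENNReal.ofReal_sum_of_nonneg fun _ _ => (Real.exp_pos _).le]
  refine ENNReal.ofReal_le_ofReal ?_
  calc ∑ j ∈ Finset.range J, Real.exp (-((j : ℝ) + v))
      ≤ ∑ j ∈ Finset.range J, (1 / 2 : ℝ) ^ j * Real.exp (-v) := by
        refine Finset.sum_le_sum fun j _ => ?_
        rw [neg_add, Real.exp_add]
        refine mul_le_mul_of_nonneg_right ?_ (Real.exp_pos _).le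
        rw [show -(j : ℝ) = j * (-1) by ring, Real.exp_nat_mul]
        refine pow_le_pow_left₀ (Real.exp_pos _).le ?_ j
        rw [Real.exp_neg, one_div]
        have := Real.add_one_le_exp (1 : ℝ)
        gcongr
        linarith
    _ ≤ 2 * Real.exp (-v) := by
        rw [← Finset.sum_mul]
        exact mul_le_mul_of_nonneg_right (sum_geometric_two_le J) (Real.exp_pos _).le

variable {Ω : Type*} [MeasurableSpace Ω] {P : Measure Ω} [IsProbabilityMeasure P]
  {O : ℕ → Ω → Obs d K} {g : ℕ → Ω → ActFun d K}

/-- Outside an event of small probability, the deviation is uniformly of order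
`(δ t) ^ (-1 / 2)`. -/
lemma LowerChain.exists_event [NeZero K] {𝓗 : Set (ActFun d K)} {A B : ℝ} {H : ℕ → ℝ}
    (c : LowerChain ν 𝓗 A B H) (hA : 0 ≤ A) (hB : 0 < B) (hH : ∀ j, 0 ≤ H j) {v : ℝ} (hv : 0 ≤ v)
    (hsum : Summable (linkConst A B H v)) (h𝓗m : ∀ h ∈ 𝓗, Measurable h)
    (h𝓗b : ∀ h ∈ 𝓗, ∀ x, |h x| ≤ B)
    (hp : IsBanditProcess ν Q P O g) {t : ℕ}
    (ht : 1 ≤ t) {δ : ℝ} (hδ : 0 < δ) (hδt : 1 ≤ δ * t)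
    (hg : ∀ τ ∈ Finset.Icc 1 t, ∀ᵐ ω ∂P, ∀ a, δ ≤ g τ ω (a, (O τ ω).1.2)) :
    ∃ E : Set Ω, P E ≤ ENNReal.ofReal (3 * Real.exp (-v)) ∧ ∀ ω ∉ E, ∀ h ∈ 𝓗,
      deviation ν Q (fun τ => O τ ω) (fun τ => g τ ω) t h ≤
        chainConst A B H v / √(δ * t) := by
  set r := √(δ * t) with hr
  have hr1 : 1 ≤ r := by rw [hr]; exact Real.one_le_sqrt.2 hδt
  have hr0 : 0 < r := by linarith
  have hrr : δ * t = r * r := (Real.mul_self_sqrt (by linarith)).symm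
  -- The last level, `2^J ≤ r < 2^(J+1)`: the lower inequality keeps the tail bound applicable to
  -- every link, the upper one makes the final bracket width at most `2 * A / r`.
  obtain ⟨J, hJ1, hJ2⟩ := exists_nat_pow_near hr1 (one_lt_two : (1 : ℝ) < 2)
  set D : ActFun d K → Ω → ℝ :=
    fun h ω => deviation ν Q (fun τ => O τ ω) (fun τ => g τ ω) t h with hD
  set E0 : Set Ω := ⋃ i, {ω | (B / 2 + 2 * B * (H 0 + v)) / r ≤ D (c.lower 0 i) ω} with hE0
  -- All pairs of consecutive levels are allowed, but only those that are `L²`-close count; the two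
  -- approximants of one `h` are always close in this sense.
  set E1 : ℕ → Set Ω := fun j => ⋃ p : Fin (c.card (j + 1)) × Fin (c.card j),
    {ω | ∫ x, (c.lower (j + 1) p.1 - c.lower j p.2) x ^ 2 ∂(refDesign K ν) ≤ 4 * (A / 2 ^ j) ^ 2 ∧
      linkConst A B H v j / r ≤ D (c.lower (j + 1) p.1 - c.lower j p.2) ω} with hE1
  refine ⟨E0 ∪ ⋃ j ∈ Finset.range J, E1 j, ?_, ?_⟩
  · have h0 : P E0 ≤ ENNReal.ofReal (Real.exp (-v)) := by
      refine measure_iUnion_le_exp (c := H 0) (by simpa using c.card_le 0) fun i => ?_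
      have hs : 0 < (2 * B * r)⁻¹ := by positivity
      refine le_trans (measure_mono ?_) (hp.measure_deviation_le ht hδ hg
        (c.measurable_lower 0 i) (c.abs_lower_le 0 i) (V := B ^ 2) ?_ hs ?_ (H 0 + v))
      · intro ω hω
        rw [Set.mem_ofPred_eq] at hω ⊢
        refine le_trans (le_of_eq ?_) hω
        rw [hrr]; field_simp
      · calc _ ≤ ∫ x, B ^ 2 ∂(refDesign K ν) := by
              refine integral_mono_of_nonneg (.of_forall fun x => sq_nonneg _)
                (integrable_const _) (.of_forall fun x => ?_)
              exact sq_le_sq' (abs_le.1 (c.abs_lower_le 0 i x)).1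
                (abs_le.1 (c.abs_lower_le 0 i x)).2
          _ = B ^ 2 := by simp
      · rw [inv_mul_le_one₀ (by positivity)]
        nlinarith
    have h1 : ∀ j ∈ Finset.range J, P (E1 j) ≤ ENNReal.ofReal (Real.exp (-((j : ℝ) + v))) := by
      intro j hj
      refine measure_iUnion_le_exp (c := H j + H (j + 1)) ?_ fun p => ?_
      · rw [Fintype.card_prod, Fintype.card_fin, Fintype.card_fin, Nat.cast_mul, add_comm (H j),
          Real.exp_add]
        exact mul_le_mul (c.card_le _) (c.card_le _) (by positivity) (Real.exp_pos _).le
      · by_cases hcond : ∫ x, (c.lower (j + 1) p.1 - c.lower j p.2) x ^ 2 ∂(refDesign K ν) ≤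
          4 * (A / 2 ^ j) ^ 2
        swap
        · refine (measure_mono (t := ∅) fun ω hω => ?_).trans (by simp)
          rw [Set.mem_ofPred_eq] at hω
          exact (hcond hω.1).elim
        -- The largest `s` of the form `2^j` times a constant that satisfies `s * (2 * B) ≤ 1` for
        -- all `2^j ≤ r`. With variance `4 * (A / 2^j)^2`, both terms of the tail bound then decay
        -- like `1 / (2^j * r)`, which gives `linkConst`.
        have hs : 0 < 2 ^ j / (2 * B * r) := by positivity
        refine le_trans (measure_mono ?_) (hp.measure_deviation_le ht hδ hg
          (h := c.lower (j + 1) p.1 - c.lower j p.2) (b := 2 * B)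
          ((c.measurable_lower _ _).sub (c.measurable_lower _ _)) ?_ hcond hs ?_
          (H j + H (j + 1) + (j + v)))
        · intro ω hω
          rw [Set.mem_ofPred_eq] at hω ⊢
          refine le_trans (le_of_eq ?_) hω.2
          rw [hrr, linkConst]; field_simp; ring
        · intro x
          refine (abs_sub _ _).trans ?_
          linarith [c.abs_lower_le (j + 1) p.1 x, c.abs_lower_le j p.2 x]
        · rw [div_mul_eq_mul_div, div_le_one (by positivity), mul_comm]
          refine mul_le_mul_of_nonneg_left ?_ (by positivity)
          exact (pow_le_pow_right₀ one_le_two (Finset.mem_range.1 hj).le).trans hJ1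
    calc P (E0 ∪ ⋃ j ∈ Finset.range J, E1 j)
        ≤ P E0 + ∑ j ∈ Finset.range J, P (E1 j) :=
          (measure_union_le _ _).trans (by gcongr; exact measure_biUnion_finset_le _ _)
      _ ≤ ENNReal.ofReal (Real.exp (-v)) + ENNReal.ofReal (2 * Real.exp (-v)) := by
          gcongr
          exact (Finset.sum_le_sum h1).trans (sum_ofReal_exp_le J v)
      _ = _ := by
          rw [← ENNReal.ofReal_add (by positivity) (by positivity)]
          congr 1; ring
  · intro ω hω h hh
    choose i hi using fun j => c.exists_lower h hh j
    have hhm := h𝓗m h hh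
    have hhb := h𝓗b h hh
    have hLm := fun j => c.measurable_lower j (i j)
    have hLb := fun j => c.abs_lower_le j (i j)
    have hω0 : D (c.lower 0 (i 0)) ω ≤ (B / 2 + 2 * B * (H 0 + v)) / r := by
      by_contra hcon
      exact hω (Or.inl (Set.mem_iUnion.2 ⟨i 0, (not_le.1 hcon).le⟩))
    have hsq : ∀ j, Integrable (fun x => (h x - c.lower j (i j) x) ^ 2) (refDesign K ν) := by
      intro j
      refine integrable_of_bdd (C := (2 * B) ^ 2)
        ((hhm.sub (hLm j)).pow_const 2).aestronglyMeasurable (.of_forall fun x => ?_)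
      rw [abs_pow]
      refine pow_le_pow_left₀ (abs_nonneg _) ((abs_sub _ _).trans ?_) 2
      linarith [hhb x, hLb j x]
    have hω1 : ∀ j < J, D (c.lower (j + 1) (i (j + 1)) - c.lower j (i j)) ω ≤
        linkConst A B H v j / r := by
      intro j hj
      by_contra hcon
      refine hω (Or.inr (Set.mem_iUnion₂.2 ⟨j, Finset.mem_range.2 hj, Set.mem_iUnion.2
        ⟨(i (j + 1), i j), ?_, (not_le.1 hcon).le⟩⟩))
      calc ∫ x, (c.lower (j + 1) (i (j + 1)) - c.lower j (i j)) x ^ 2 ∂(refDesign K ν)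
          ≤ ∫ x, (2 * (h x - c.lower j (i j) x) ^ 2 +
              2 * (h x - c.lower (j + 1) (i (j + 1)) x) ^ 2) ∂(refDesign K ν) := by
            refine integral_mono_of_nonneg (.of_forall fun x => sq_nonneg _)
              (((hsq j).const_mul 2).add ((hsq (j + 1)).const_mul 2)) (.of_forall fun x => ?_)
            simp only [Pi.sub_apply]
            nlinarith [sq_nonneg ((h x - c.lower j (i j) x) +
              (h x - c.lower (j + 1) (i (j + 1)) x))]
        _ ≤ 2 * (A / 2 ^ j) ^ 2 + 2 * (A / 2 ^ (j + 1)) ^ 2 := by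
            rw [integral_add ((hsq j).const_mul 2) ((hsq (j + 1)).const_mul 2),
              integral_const_mul, integral_const_mul]
            linarith [(hi j).2, (hi (j + 1)).2]
        _ ≤ 4 * (A / 2 ^ j) ^ 2 := by
            have : (A / 2 ^ (j + 1)) ^ 2 ≤ (A / 2 ^ j) ^ 2 := by
              gcongr <;> simp
            linarith
    -- Telescoping from the coarsest approximant up to level `m`.
    have htel : ∀ m ≤ J, D (c.lower m (i m)) ω ≤ (B / 2 + 2 * B * (H 0 + v)) / r +
        ∑ j ∈ Finset.range m, linkConst A B H v j / r := by
      intro m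
      induction m with
      | zero => intro _; simpa using hω0
      | succ m ih =>
        intro hm
        have h1 := hω1 m hm
        have h2 := ih (by omega)
        have h3 := deviation_sub (ν := ν) (Q := Q) (hLm (m + 1)) (hLm m) (hLb (m + 1)) (hLb m)
          (fun τ => O τ ω) (fun τ => g τ ω) t
        rw [Finset.sum_range_succ]
        simp only [hD] at h1 h2 ⊢
        linarith
    have hpos : ∀ j, 0 ≤ linkConst A B H v j := by
      intro j
      have := hH j
      have := hH (j + 1)
      unfold linkConst
      positivity
    -- Below the last scale no concentration is needed: the empirical risk is monotone, and the gap
    -- in risk is at most the `L²` width.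
    have hlast : deviation ν Q (fun τ => O τ ω) (fun τ => g τ ω) t h ≤
        D (c.lower J (i J)) ω + A / 2 ^ J := by
      have h1 : risk ν Q id (h - c.lower J (i J)) ≤ A / 2 ^ J := by
        refine risk_le_of_integral_sq_le (hhm.sub (hLm J)) (b := 2 * B) (fun x => ?_)
          (by positivity) (hi J).2
        refine (abs_sub _ _).trans ?_
        linarith [hhb x, hLb J x]
      rw [risk_sub hhm (hLm J) hhb (hLb J)] at h1
      have h2 : empRisk id (fun τ => O τ ω) (fun τ => g τ ω) t (c.lower J (i J)) ≤
          empRisk id (fun τ => O τ ω) (fun τ => g τ ω) t h := by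
        refine empRisk_mono (fun τ hτ x => ?_) (hi J).1
        obtain ⟨k, rfl⟩ : ∃ k, τ = k + 1 := ⟨τ - 1, by have := (Finset.mem_Icc.1 hτ).1; omega⟩
        exact (hp.isPolicy k ω).1 x
      simp only [hD, deviation]
      linarith
    have hAJ : A / 2 ^ J ≤ 2 * A / r := by
      rw [div_le_div_iff₀ (by positivity) hr0]
      rw [pow_succ] at hJ2
      nlinarith
    have hts : ∑ j ∈ Finset.range J, linkConst A B H v j / r ≤
        (∑' j, linkConst A B H v j) / r := by
      rw [← Finset.sum_div]
      gcongr
      exact hsum.sum_le_tsum _ fun j _ => hpos j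
    have h4 := htel J le_rfl
    have h5 : chainConst A B H v / r = (B / 2 + 2 * B * (H 0 + v)) / r +
        (∑' j, linkConst A B H v j) / r + 2 * A / r := by
      unfold chainConst; ring
    rw [h5]
    linarith

end Chaining

/-! ### From the entropy rate to covers and a summable chain. -/

section Entropy

lemma exists_coveredByBrackets {X : Type*} [MeasurableSpace X] {μ : Measure X} {r : ℝ≥0∞}
    {F : Set (X → ℝ)} {ε : ℝ} (h : bracketingNumber μ r F ε ≠ ⊤) :
    CoveredByBrackets μ r F ε (bracketingNumber μ r F ε).toNat := by
  classical
  have hex : ∃ n, CoveredByBrackets μ r F ε n := by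
    by_contra hcon
    push Not at hcon
    exact h (by simp [bracketingNumber, hcon])
  have : bracketingNumber μ r F ε = (Nat.find hex : ℕ∞) :=
    le_antisymm (iInf₂_le _ (Nat.find_spec hex))
      (le_iInf₂ fun n hn => by exact_mod_cast Nat.find_min' hex hn)
  rw [this, ENat.toNat_natCast]
  exact Nat.find_spec hex

lemma HasBracketingEntropyRate.exists_cover {X : Type*} [MeasurableSpace X] {μ : Measure X}
    {r : ℝ≥0∞} {F : Set (X → ℝ)} {p : ℝ} (h : HasBracketingEntropyRate μ r F p) :
    ∃ ε₀ > 0, ∃ C ≥ 0, ∀ ε, 0 < ε → ε ≤ ε₀ →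
      ∃ n : ℕ, CoveredByBrackets μ r F ε n ∧ (n : ℝ) ≤ Real.exp (C * ε ^ (-p)) := by
  obtain ⟨C, hC0, hC⟩ := h.2.exists_nonneg
  obtain ⟨ε₀, hε₀, hsub⟩ := mem_nhdsGT_iff_exists_Ioc_subset.1 (h.1.and hC.bound)
  refine ⟨ε₀, hε₀, C, hC0, fun ε h0 h1 => ?_⟩
  obtain ⟨hfin, hle⟩ := hsub ⟨h0, h1⟩
  refine ⟨_, exists_coveredByBrackets hfin, ?_⟩
  have hn : (0 : ℝ) < 1 + ((bracketingNumber μ r F ε).toNat : ℝ) := by positivity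
  rw [Real.norm_of_nonneg (Real.log_nonneg (by simp)),
    Real.norm_of_nonneg (Real.rpow_nonneg h0.le _), Real.log_le_iff_le_exp hn] at hle
  linarith

lemma integral_sq_le_of_eLpNorm_le {X : Type*} [MeasurableSpace X] {μ : Measure X} {w : X → ℝ}
    (hw : AEStronglyMeasurable w μ) {ε : ℝ} (hε : 0 ≤ ε)
    (h : eLpNorm w 2 μ ≤ ENNReal.ofReal ε) : ∫ x, w x ^ 2 ∂μ ≤ ε ^ 2 := by
  have hm : MemLp w 2 μ := ⟨hw, h.trans_lt ENNReal.ofReal_lt_top⟩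
  rw [hm.eLpNorm_eq_integral_rpow_norm two_ne_zero ENNReal.ofNat_ne_top,
    ENNReal.ofReal_le_ofReal_iff hε] at h
  simp only [ENNReal.toReal_ofNat, Real.rpow_two, Real.norm_eq_abs, sq_abs] at h
  have h0 : 0 ≤ ∫ x, w x ^ 2 ∂μ := integral_nonneg fun x => sq_nonneg _
  calc ∫ x, w x ^ 2 ∂μ = ((∫ x, w x ^ 2 ∂μ) ^ (2 : ℝ)⁻¹) ^ 2 := by
        rw [← Real.rpow_natCast, ← Real.rpow_mul h0]; norm_num
    _ ≤ ε ^ 2 := pow_le_pow_left₀ (Real.rpow_nonneg h0 _) h 2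

/-- Here `q` stands for `2 ^ p`, the growth factor of the entropy when the scale is halved; `q < 2`
is where `p < 1` enters. -/
lemma summable_linkConst (A B C v : ℝ) {q : ℝ} (hq0 : 0 ≤ q) (hq : q < 2) :
    Summable (linkConst A B (fun j => C * q ^ j) v) := by
  have h1 : Summable fun j : ℕ => (1 / 2 : ℝ) ^ j := summable_geometric_two
  have h2 : Summable fun j : ℕ => (q / 2) ^ j :=
    summable_geometric_of_lt_one (by positivity) (by linarith)
  have h3 : Summable fun j : ℕ => (j : ℝ) ^ 1 * (1 / 2 : ℝ) ^ j :=
    summable_pow_mul_geometric_of_norm_lt_one (R := ℝ) 1 (by norm_num)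
  have e : linkConst A B (fun j => C * q ^ j) v = fun j : ℕ =>
      (2 * A ^ 2 / B + 2 * B * v) * (1 / 2 : ℝ) ^ j + 2 * B * C * (1 + q) * (q / 2) ^ j +
        2 * B * ((j : ℝ) ^ 1 * (1 / 2 : ℝ) ^ j) := by
    funext j
    simp only [linkConst, one_div, inv_pow, div_pow, pow_succ]
    ring
  rw [e]
  exact ((h1.mul_left _).add (h2.mul_left _)).add (h3.mul_left _)

end Entropy

/-! ### Transfer to the surrogate losses, and exploration of the greedy designs. -/

section Surrogate

lemma Variant.phi_mono (v : Variant) {x y : ℝ} (h : x ≤ y) : v.phi x ≤ v.phi y := by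
  cases v
  · exact h
  · exact max_le_max le_rfl (by linarith)

lemma Variant.phi_sub_le (v : Variant) {x y : ℝ} (h : x ≤ y) : v.phi y - v.phi x ≤ y - x := by
  cases v
  · exact le_rfl
  · change max 0 (1 + y) - max 0 (1 + x) ≤ y - x
    rcases max_cases 0 (1 + y) with h1 | h1 <;> rcases max_cases 0 (1 + x) with h2 | h2 <;>
      linarith

lemma Variant.measurable_phi (v : Variant) : Measurable v.phi := by
  cases v
  · exact measurable_id
  · exact measurable_const.max (measurable_const.add measurable_id)

variable {d K : ℕ}

lemma Variant.measurable_of_mem_regressors {v : Variant} {F₀ : Set (Ctx d → ℝ)}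
    (hF₀ : ∀ f ∈ F₀, Measurable f) {f : ActFun d K} (hf : f ∈ v.regressors F₀) :
    Measurable f := by
  refine measurable_from_prod_countable_right fun a => ?_
  cases v
  · exact hF₀ _ (hf.1 a)
  · exact hF₀ _ (hf.1 a)

/-- The surrogate losses of the members of `F`, relative to that of `f₀`. -/
def surrogateDiff (φ : ℝ → ℝ) (F : Set (ActFun d K)) (f₀ : ActFun d K) : Set (ActFun d K) :=
  {h | ∃ f ∈ F, h = fun x => φ (f x) - φ (f₀ x)}

/-- Brackets for `F` give chains for the surrogate losses. -/
lemma nonempty_lowerChain {ν : Measure (Ctx d)} {v : Variant} {F : Set (ActFun d K)}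
    {f₀ : ActFun d K} (hf₀ : Measurable f₀) (hF : ∀ f ∈ F, Measurable f) {B : ℝ} (hB : 0 < B)
    (hFB : ∀ f ∈ F, ∀ x, |v.phi (f x) - v.phi (f₀ x)| ≤ B)
    {p ε₀ C : ℝ} (hε₀ : 0 < ε₀)
    (hcov : ∀ ε, 0 < ε → ε ≤ ε₀ → ∃ n : ℕ, CoveredByBrackets (refDesign K ν) 2 F ε n ∧
      (n : ℝ) ≤ Real.exp (C * ε ^ (-p))) :
    Nonempty (LowerChain ν (surrogateDiff v.phi F f₀) ε₀ B
      (fun j => C * ε₀ ^ (-p) * (2 ^ p) ^ j)) := by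
  have hε : ∀ j : ℕ, 0 < ε₀ / 2 ^ j := fun j => by positivity
  choose n hn hcard using fun j : ℕ => hcov (ε₀ / 2 ^ j) (hε j)
    (div_le_self hε₀.le (one_le_pow₀ one_le_two))
  choose l u hlu hex using hn
  -- Brackets need not be bounded, so the lower ends are clipped to `[-B, B]`. As `φ` is monotone
  -- and 1-Lipschitz and the target lies in `[-B, B]`, clipping keeps them below it and does not
  -- widen the gap.
  refine ⟨⟨n, fun j i x => min B (max (-B) (v.phi (l j i x) - v.phi (f₀ x))), fun j i => ?_,
    fun j i x => ?_, fun j => ?_, ?_⟩⟩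
  · exact measurable_const.min (measurable_const.max
      ((v.measurable_phi.comp (hlu j i).1).sub (v.measurable_phi.comp hf₀)))
  · exact abs_le.2 ⟨le_min (by linarith) (le_max_left _ _), min_le_left _ _⟩
  · refine (hcard j).trans (Real.exp_le_exp.2 (le_of_eq ?_))
    rw [Real.div_rpow hε₀.le (by positivity), Real.rpow_neg (by positivity : (0 : ℝ) ≤ 2 ^ j),
      div_inv_eq_mul, mul_assoc, ← Real.rpow_natCast, ← Real.rpow_natCast,
      ← Real.rpow_mul zero_le_two, ← Real.rpow_mul zero_le_two, mul_comm p]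
  · rintro h ⟨f, hf, rfl⟩ j
    obtain ⟨i, hi⟩ := hex j f hf
    have hb := fun x => abs_le.1 (hFB f hf x)
    have hle : ∀ x, min B (max (-B) (v.phi (l j i x) - v.phi (f₀ x))) ≤
        v.phi (f x) - v.phi (f₀ x) := fun x =>
      (min_le_right _ _).trans (max_le (hb x).1 (sub_le_sub_right (v.phi_mono (hi x).1) _))
    refine ⟨i, hle, ?_⟩
    refine integral_sq_le_of_eLpNorm_le (Measurable.aestronglyMeasurable ?_) (hε j).le
      ((eLpNorm_mono fun x => ?_).trans (hlu j i).2.2)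
    · exact ((v.measurable_phi.comp (hF f hf)).sub (v.measurable_phi.comp hf₀)).sub
        (measurable_const.min (measurable_const.max
          ((v.measurable_phi.comp (hlu j i).1).sub (v.measurable_phi.comp hf₀))))
    · have h1 : v.phi (l j i x) - v.phi (f₀ x) ≤
          min B (max (-B) (v.phi (l j i x) - v.phi (f₀ x))) :=
        le_min ((sub_le_sub_right (v.phi_mono (hi x).1) _).trans (hb x).2) (le_max_right _ _)
      rw [Real.norm_of_nonneg (sub_nonneg.2 (hle x)),
        Real.norm_of_nonneg (by linarith [(hi x).1, (hi x).2])]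
      linarith [v.phi_sub_le (hi x).1, (hi x).2]

lemma empRisk_sub_empRisk (φ : ℝ → ℝ) (O : ℕ → Obs d K) (g : ℕ → ActFun d K) (t : ℕ)
    (f f₀ : ActFun d K) : empRisk φ O g t f - empRisk φ O g t f₀ =
      empRisk id O g t fun x => φ (f x) - φ (f₀ x) := by
  unfold empRisk
  rw [← mul_sub, ← Finset.sum_sub_distrib]
  congr 1
  refine Finset.sum_congr rfl fun τ _ => ?_
  simp only [isLoss, loss, id]
  ring

/-- The difference of two risks whose losses differ by a bounded function. -/
lemma risk_sub_risk [NeZero K] {ν : Measure (Ctx d)} [IsProbabilityMeasure ν]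
    {Q : Kernel (Fin K × Ctx d) (Fin 2)} [IsMarkovKernel Q] {φ : ℝ → ℝ} (hφ : Measurable φ)
    {f f₀ : ActFun d K} (hf : Measurable f) (hf₀ : Measurable f₀) {B : ℝ}
    (hB : ∀ x, |φ (f x) - φ (f₀ x)| ≤ B) :
    risk ν Q φ f - risk ν Q φ f₀ = 0 ∨
      risk ν Q φ f - risk ν Q φ f₀ = risk ν Q id fun x => φ (f x) - φ (f₀ x) := by
  have hi : Integrable (loss id fun x => φ (f x) - φ (f₀ x)) (refLaw ν Q) :=
    integrable_loss_id ((hφ.comp hf).sub (hφ.comp hf₀)) hB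
  have e : ∀ o : Obs d K, loss φ f o =
      loss φ f₀ o + loss id (fun x => φ (f x) - φ (f₀ x)) o := fun o => by
    simp only [loss, id]; ring
  -- Only differences of losses are known to be bounded. If one loss is not integrable then neither
  -- is the other, and both risks take the default value `0` of the integral.
  by_cases h : Integrable (loss φ f₀) (refLaw ν Q)
  · right
    unfold risk
    rw [sub_eq_iff_eq_add', ← integral_add h hi]
    exact integral_congr_ae (.of_forall e)
  · left
    have h' : ¬ Integrable (loss φ f) (refLaw ν Q) := fun h1 => h <| by
      refine (h1.sub hi).congr (.of_forall fun o => ?_)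
      simp only [Pi.sub_apply, e o]
      exact add_sub_cancel_right _ _
    unfold risk
    rw [integral_undef h, integral_undef h', sub_zero]

/-- The uniform component of the mixture alone contributes `δ (n + 1) / K`, and the greedy component
is nonnegative. -/
lemma IsEpsGreedyRun.design_lower_bound {Ω : Type*} [MeasurableSpace Ω] {v : Variant}
    {F₀ : Set (Ctx d → ℝ)} {δ : ℕ → ℝ} {ν : Measure (Ctx d)}
    {Q : Kernel (Fin K × Ctx d) (Fin 2)} {P : Measure Ω} {O : ℕ → Ω → Obs d K}
    {g fhat pihat : ℕ → Ω → ActFun d K} (h : IsEpsGreedyRun v F₀ δ ν Q P O g fhat pihat) (n : ℕ) :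
    ∀ᵐ ω ∂P, ∀ x, δ (n + 1) / K ≤ g (n + 1) ω x := by
  have hpi : ∀ᵐ ω ∂P, ∀ x, 0 ≤ pihat n ω x := by
    cases n with
    | zero =>
      filter_upwards [h.init] with ω hω x
      simp only [hω, gref]; positivity
    | succ m =>
      filter_upwards [h.fit m, h.greedy m] with ω h1 h2 x
      cases v with
      | direct =>
        rw [show pihat (m + 1) ω = fhat (m + 1) ω from h2]
        exact (h1.1.2 x.2).1 x.1
      | hinge =>
        obtain ⟨s, -, hs⟩ := h2
        rw [show x = (x.1, x.2) from rfl, hs]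
        split_ifs <;> norm_num
  filter_upwards [h.design n, hpi] with ω h1 h2 x
  have h3 := mul_nonneg (sub_nonneg.2 (h.rate_mem n).2) (h2 x)
  simp only [h1, gref, div_eq_mul_inv]
  linarith

/-- Justifies the confidence parameter `v = 3 / η` in the chaining bound, through `x ≤ exp x`. -/
lemma ofReal_three_mul_exp_le {η : ℝ} (hη : 0 < η) :
    ENNReal.ofReal (3 * Real.exp (-(3 / η))) ≤ ENNReal.ofReal η := by
  refine ENNReal.ofReal_le_ofReal ?_
  have h : 3 / η ≤ Real.exp (3 / η) := by linarith [Real.add_one_le_exp (3 / η)]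
  rw [Real.exp_neg, ← div_eq_mul_inv, div_le_iff₀ (Real.exp_pos _)]
  calc (3 : ℝ) = η * (3 / η) := by field_simp
    _ ≤ _ := by gcongr

end Surrogate

/-! ### Assembly of the bound and the two cases of the theorem. -/

/-- The excess risk of empirical risk minimizers is `O_P((δ t) ^ (-1 / 2))`, uniformly over the
bandit processes whose designs are bounded below by `δ`. -/
theorem exists_excess_risk_bound {d K : ℕ} [NeZero K] (v : Variant)
    {F₀ : Set (Ctx d → ℝ)} (hF₀ : ∀ f ∈ F₀, Measurable f)
    (ν : Measure (Ctx d)) [IsProbabilityMeasure ν]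
    (Q : Kernel (Fin K × Ctx d) (Fin 2)) [IsMarkovKernel Q]
    {B : ℝ} (hB : 0 < B) (hFB : ∀ f₁ ∈ (v.regressors F₀ : Set (ActFun d K)),
      ∀ f₂ ∈ (v.regressors F₀ : Set (ActFun d K)), ∀ x, |v.phi (f₁ x) - v.phi (f₂ x)| ≤ B)
    {fstar : ActFun d K} (hfstar : IsArgmin (risk ν Q v.phi) (v.regressors F₀) fstar)
    {p : ℝ} (hp : p < 1)
    (hent : HasBracketingEntropyRate (refDesign K ν) 2 (v.regressors F₀) p)
    {η : ℝ} (hη : 0 < η) : ∃ M : ℝ, 0 ≤ M ∧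
      ∀ (Ω : Type u) [MeasurableSpace Ω] (P : Measure Ω) [IsProbabilityMeasure P]
        (O : ℕ → Ω → Obs d K) (g : ℕ → Ω → ActFun d K),
        IsBanditProcess ν Q P O g →
        ∀ (t : ℕ) (δ : ℝ), 1 ≤ t → 0 < δ →
        (∀ τ ∈ Finset.Icc 1 t, ∀ᵐ ω ∂P, ∀ a, δ ≤ g τ ω (a, (O τ ω).1.2)) →
        ∀ fhat : Ω → ActFun d K,
        (∀ᵐ ω ∂P, IsArgmin (empRisk v.phi (fun τ => O τ ω) (fun τ => g τ ω) t)
          (v.regressors F₀) (fhat ω)) →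
        P {ω | M / √(δ * t) <
            |risk ν Q v.phi (fhat ω) - risk ν Q v.phi fstar|} ≤ ENNReal.ofReal η := by
  obtain ⟨ε₀, hε₀, C, hC, hcov⟩ := hent.exists_cover
  have hFm : ∀ f ∈ (v.regressors F₀ : Set (ActFun d K)), Measurable f :=
    fun f hf => Variant.measurable_of_mem_regressors hF₀ hf
  have hsm := hFm _ hfstar.1
  have hFB' := fun f hf => hFB f hf fstar hfstar.1
  obtain ⟨c⟩ := nonempty_lowerChain (ν := ν) (v := v) hsm hFm hB hFB' hε₀ hcov
  set H : ℕ → ℝ := fun j => C * ε₀ ^ (-p) * (2 ^ p) ^ j with hH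
  have hq : (2 : ℝ) ^ p < 2 := by
    simpa using Real.rpow_lt_rpow_of_exponent_lt one_lt_two hp
  have hsum := summable_linkConst ε₀ B (C * ε₀ ^ (-p)) (3 / η) (by positivity) hq
  have hdiff : ∀ f ∈ (v.regressors F₀ : Set (ActFun d K)), _ :=
    fun f hf => risk_sub_risk (ν := ν) (Q := Q) v.measurable_phi (hFm f hf) hsm (hFB' f hf)
  have habs : ∀ f ∈ (v.regressors F₀ : Set (ActFun d K)),
      |risk ν Q v.phi f - risk ν Q v.phi fstar| = risk ν Q v.phi f - risk ν Q v.phi fstar :=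
    fun f hf => abs_of_nonneg (sub_nonneg.2 (hfstar.2 hf))
  refine ⟨max B (chainConst ε₀ B H (3 / η)), hB.le.trans (le_max_left _ _), ?_⟩
  intro Ω _ P _ O g hproc t δ ht hδ hg fhat hfhat
  have hN : 0 < δ * t := mul_pos hδ (by exact_mod_cast ht)
  set M := max B (chainConst ε₀ B H (3 / η)) with hM
  have hM0 : 0 ≤ M / √(δ * t) := div_nonneg (hB.le.trans (le_max_left _ _)) (Real.sqrt_nonneg _)
  -- In the degenerate case of `risk_sub_risk` the excess risk is zero, so bounding the risk of the
  -- difference of losses is enough.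
  suffices hE : ∃ E : Set Ω, P E ≤ ENNReal.ofReal η ∧ ∀ ω ∉ E,
      IsArgmin (empRisk v.phi (fun τ => O τ ω) (fun τ => g τ ω) t) (v.regressors F₀) (fhat ω) →
      (risk ν Q id fun x => v.phi (fhat ω x) - v.phi (fstar x)) ≤ M / √(δ * t) by
    obtain ⟨E, hPE, hE⟩ := hE
    refine (measure_mono_ae ?_).trans hPE
    filter_upwards [hfhat] with ω hω hlt
    by_contra hωE
    have h1 := hE ω hωE hω
    have hlt : M / √(δ * t) < |risk ν Q v.phi (fhat ω) - risk ν Q v.phi fstar| := hlt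
    rw [habs _ hω.1] at hlt
    rcases hdiff _ hω.1 with h2 | h2 <;> linarith
  -- For `δ * t < 1` the target exceeds `B`, which bounds the excess trivially; chaining needs `δ *
  -- t ≥ 1`.
  rcases lt_or_ge (δ * t) 1 with hlt | hge
  · refine ⟨∅, by simp, fun ω _ hω => ?_⟩
    have h1 : (risk ν Q id fun x => v.phi (fhat ω x) - v.phi (fstar x)) ≤ B := by
      unfold risk
      calc _ ≤ ∫ _o, B ∂(refLaw ν Q) := by
            refine integral_mono (integrable_loss_id ((v.measurable_phi.comp (hFm _ hω.1)).sub
              (v.measurable_phi.comp hsm)) (hFB' _ hω.1)) (integrable_const _) fun o => ?_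
            exact (le_abs_self _).trans (abs_loss_id_le (hFB' _ hω.1) o)
        _ = B := by simp
    refine h1.trans ((le_max_left B (chainConst ε₀ B H (3 / η))).trans ?_)
    exact le_div_self (hB.le.trans (le_max_left _ _)) (Real.sqrt_pos.2 hN)
      (Real.sqrt_le_one.2 hlt.le)
  · obtain ⟨E, hPE, hE⟩ := c.exists_event hε₀.le hB (fun j => by positivity)
      (by positivity : 0 ≤ 3 / η) hsum
      (by
        rintro h ⟨f, hf, rfl⟩
        exact (v.measurable_phi.comp (hFm _ hf)).sub (v.measurable_phi.comp hsm))
      (by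
        rintro h ⟨f, hf, rfl⟩
        exact hFB' f hf) hproc ht hδ hge hg
    refine ⟨E, hPE.trans (ofReal_three_mul_exp_le hη), fun ω hωE hω => ?_⟩
    have h1 := hE ω hωE _ ⟨_, hω.1, rfl⟩
    rw [deviation, ← empRisk_sub_empRisk] at h1
    have h2 : empRisk v.phi (fun τ => O τ ω) (fun τ => g τ ω) t (fhat ω) ≤
        empRisk v.phi (fun τ => O τ ω) (fun τ => g τ ω) t fstar := hω.2 hfstar.1
    have h3 : chainConst ε₀ B H (3 / η) / √(δ * t) ≤ M / √(δ * t) := by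
      gcongr
      exact le_max_right _ _
    linarith

end EpsGreedy

open EpsGreedy in
theorem mainTheorem6 (d K : ℕ) (hK : 2 ≤ K) (v : Variant)
    (F₀ : Set (Ctx d → ℝ)) (hF₀ : ∀ f ∈ F₀, Measurable f)
    (ν : Measure (Ctx d)) [IsProbabilityMeasure ν]
    (Q : Kernel (Fin K × Ctx d) (Fin 2)) [IsMarkovKernel Q]
    (hB : ∃ B : ℝ, 0 < B ∧ ∀ f₁ ∈ (v.regressors F₀ : Set (ActFun d K)),
      ∀ f₂ ∈ (v.regressors F₀ : Set (ActFun d K)), ∀ x, |v.phi (f₁ x) - v.phi (f₂ x)| ≤ B)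
    (fstar : ActFun d K) (hfstar : IsArgmin (risk ν Q v.phi) (v.regressors F₀) fstar)
    (p : ℝ) (hp : p ∈ Set.Ioo (0 : ℝ) 1)
    (hent : HasBracketingEntropyRate (refDesign K ν) 2 (v.regressors F₀) p) :
    ∀ η : ℝ, 0 < η → ∃ M : ℝ,
      -- arbitrary predictable designs that are bounded below by `δ` up to time `t`
      (∀ (Ω : Type u) [MeasurableSpace Ω] (P : Measure Ω) [IsProbabilityMeasure P]
        (O : ℕ → Ω → Obs d K) (g : ℕ → Ω → ActFun d K),
        IsBanditProcess ν Q P O g →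
        ∀ (t : ℕ) (δ : ℝ), 1 ≤ t → 0 < δ →
        (∀ τ ∈ Finset.Icc 1 t, ∀ᵐ ω ∂P, ∀ a, δ ≤ g τ ω (a, (O τ ω).1.2)) →
        ∀ fhat : Ω → ActFun d K,
        (∀ᵐ ω ∂P, IsArgmin (empRisk v.phi (fun τ => O τ ω) (fun τ => g τ ω) t)
          (v.regressors F₀) (fhat ω)) →
        P {ω | M * (δ * t) ^ (-(min (1 / 2 : ℝ) (1 / p))) <
            |risk ν Q v.phi (fhat ω) - risk ν Q v.phi fstar|} ≤ ENNReal.ofReal η) ∧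
      -- the `ε`-greedy algorithm with exploration rates bounded below by `δ₀` up to time `t`
      (∀ (Ω : Type u) [MeasurableSpace Ω] (P : Measure Ω) [IsProbabilityMeasure P]
        (O : ℕ → Ω → Obs d K) (g fhat pihat : ℕ → Ω → ActFun d K) (δ : ℕ → ℝ),
        IsEpsGreedyRun v F₀ δ ν Q P O g fhat pihat →
        ∀ (t : ℕ) (δ₀ : ℝ), 1 ≤ t → 0 < δ₀ → (∀ τ ∈ Finset.Icc 1 t, δ₀ ≤ δ τ) →
        P {ω | M * (δ₀ * t) ^ (-(min (1 / 2 : ℝ) (1 / p))) <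
            |risk ν Q v.phi (fhat t ω) - risk ν Q v.phi fstar|} ≤ ENNReal.ofReal η) := by
  intro η hη
  have : NeZero K := ⟨by omega⟩
  obtain ⟨B, hB, hFB⟩ := hB
  obtain ⟨M, hM, hbound⟩ := exists_excess_risk_bound v hF₀ ν Q hB hFB hfstar hp.2 hent hη
  have hmin : min (1 / 2 : ℝ) (1 / p) = 1 / 2 := by
    refine min_eq_left ?_
    rw [div_le_div_iff_of_pos_left one_pos two_pos hp.1]
    linarith [hp.2]
  have hpow : ∀ x : ℝ, 0 ≤ x → x ^ (-(1 / 2 : ℝ)) = (√x)⁻¹ := fun x hx => by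
    rw [Real.rpow_neg hx, Real.sqrt_eq_rpow]
  have hK1 : (1 : ℝ) ≤ K := by exact_mod_cast (by omega : 1 ≤ K)
  rw [hmin]
  -- The factor `√K` absorbs the loss from `δ₀` to `δ₀ / K` in the greedy designs, and is harmless
  -- in the first case.
  refine ⟨M * √K, ?_, ?_⟩
  · intro Ω _ P _ O g hproc t δ ht hδ hg fhat hfhat
    refine (measure_mono fun ω hω => ?_).trans (hbound Ω P O g hproc t δ ht hδ hg fhat hfhat)
    rw [Set.mem_ofPred_eq, hpow _ (by positivity)] at hω
    refine lt_of_le_of_lt ?_ hω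
    rw [div_eq_mul_inv]
    refine mul_le_mul_of_nonneg_right ?_ (by positivity)
    exact le_mul_of_one_le_right hM (Real.one_le_sqrt.2 hK1)
  · intro Ω _ P _ O g fhat pihat δ hrun t δ₀ ht hδ₀ hδ
    have hg : ∀ τ ∈ Finset.Icc 1 t, ∀ᵐ ω ∂P, ∀ a, δ₀ / K ≤ g τ ω (a, (O τ ω).1.2) := by
      intro τ hτ
      have hτδ := hδ τ hτ
      obtain ⟨n, rfl⟩ : ∃ n, τ = n + 1 := ⟨τ - 1, by have := (Finset.mem_Icc.1 hτ).1; omega⟩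
      filter_upwards [hrun.design_lower_bound n] with ω hω a
      exact (div_le_div_of_nonneg_right hτδ (by positivity)).trans (hω _)
    obtain ⟨n, rfl⟩ : ∃ n, t = n + 1 := ⟨t - 1, by omega⟩
    refine (measure_mono fun ω hω => ?_).trans (hbound Ω P O g hrun.process (n + 1) (δ₀ / K) ht
      (by positivity) hg (fhat (n + 1)) (hrun.fit n))
    rw [Set.mem_ofPred_eq, hpow _ (by positivity)] at hω
    refine lt_of_le_of_lt (le_of_eq ?_) hω
    rw [div_mul_eq_mul_div, Real.sqrt_div' _ (by positivity)]
    field_simp
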